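/- Let $\Bbbk$ be a field, let $r\in\mathbb N$ and $n_1,\dots,n_r\in\mathbb N$, and let $S=\Bbbk[x_{i,j}\mid 1\le i\le r,\ 0\le j\le n_i]$ be the $\mathbb Z^r$-graded Cox ring of $\mathbb P^{n_1}\times\cdots\times\mathbb P^{n_r}$, where $\deg x_{i,j}=\mathbf e_i$ is the $i$-th standard basis vector. For $\mathbf d\in\mathbb Z^r$ and $i\in\mathbb N$ put $$L_i(\mathbf d)=\bigcup_{\lambda\in\mathbb N^r,\ \lambda_1+\cdots+\lambda_r=i}\bigl(\mathbf d-\lambda_1\mathbf e_1-\cdots-\lambda_r\mathbf e_r+\mathbb N^r\bigr),$$ $Q_0(\mathbf d)=\mathbf d+\mathbb N^r$, and $Q_i(\mathbf d)=L_{i-1}(\mathbf d-(1,\dots,1))$ for $i>0$. A $\mathbb Z^r$-graded free resolution $F_\bullet$, with terms $F_j$ that are direct sums of twists $S(-\mathbf b)$, is called linear (respectively quasilinear) and generated in degree $\mathbf d$ if every generator of $F_0$ has degree $\mathbf d$ and, for every $j\ge 0$, every summand $S(-\mathbf b)$ of $F_j$ satisfies $-\mathbf b\in L_j(-\mathbf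 d)$ (respectively $-\mathbf b\in Q_j(-\mathbf d)$). Let $M$ be a finitely generated $\mathbb Z^r$-graded $S$-module, and let $\beta_i(M)=\{\mathbf b\in\mathbb Z^r\mid \operatorname{Tor}_i^S(M,\Bbbk)_{\mathbf b}\ne 0\}$. For $\mathbf d\in\mathbb Z^r$ let $M_{\ge\mathbf d}=\bigoplus_{\mathbf d'\ge\mathbf d}M_{\mathbf d'}$, where $\ge$ is the componentwise order. 1. If $\mathbf d\in\bigcap_{i\in\mathbb N}\bigcap_{\mathbf b\in\beta_i(M)}Q_i(\mathbf b)$, then $M_{\ge\mathbf d}$ has a quasilinear free resolution generated in degree $\mathbf d$. 2. If $\mathbf d\in\bigcap_{i\in\mathbb N}\bigcap_{\mathbf b\in\beta_i(M)}L_i(\mathbf b)$, then $M_{\ge\mathbf d}$ has a linear free resolution generated in degree $\mathbf d$. -/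

import Mathlib

open scoped DirectSum TensorProduct

universe u v w

namespace Multigraded

/-! ### The regions `L_i(d)` and `Q_i(d)` in `ℤ^r` -/

section Regions

variable {r : ℕ}

/-- `L_i(d)` is the union of the orthants `d - ∑ j, l j • e_j + ℕ^r` over all `l : ℕ^r` with
`∑ j, l j = i`. -/
def regionL (i : ℕ) (d : Fin r → ℤ) : Set (Fin r → ℤ) :=
  ⋃ l ∈ {l : Fin r → ℕ | ∑ j, l j = i}, Set.Ici (d - fun j => (l j : ℤ))

/-- `Q_0(d) = d + ℕ^r`, and `Q_i(d) = L_{i-1}(d - (1, …, 1))` for `i > 0`. -/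
def regionQ (i : ℕ) (d : Fin r → ℤ) : Set (Fin r → ℤ) :=
  match i with
  | 0 => Set.Ici d
  | i + 1 => regionL i (d - 1)

end Regions

/-! ### The Cox ring of `ℙ^{n_1} × ⋯ × ℙ^{n_r}` with its `ℤ^r`-grading -/

section CoxRing

variable (k : Type v) [Field k] {r : ℕ} (n : Fin r → ℕ)

/-- The polynomial ring over `k` in the variables `x_{i,j}`, `1 ≤ i ≤ r`, `0 ≤ j ≤ n_i`. -/
abbrev CoxRing : Type v := MvPolynomial (Σ i : Fin r, Fin (n i + 1)) k

/-- The degree of the variable `x_{i,j}` is the standard basis vector `e_i`. -/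
def varDegree (x : Σ i : Fin r, Fin (n i + 1)) : Fin r → ℤ := Pi.single x.1 1

/-- The homogeneous polynomials of degree `b`. -/
abbrev coxGrading (b : Fin r → ℤ) : Submodule k (CoxRing k n) :=
  MvPolynomial.weightedHomogeneousSubmodule k (varDegree n) b

/-- The multigrading makes the Cox ring a graded algebra. -/
noncomputable instance coxGradedAlgebra : GradedAlgebra (coxGrading k n) :=
  MvPolynomial.weightedGradedAlgebra k (varDegree n)

/-- The residue field `S / ⟨x_{i,j}⟩` of the Cox ring at the ideal of all variables; it is `k`. -/
abbrev ResidueField : Type v :=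
  CoxRing k n ⧸ (Ideal.span (Set.range MvPolynomial.X) : Ideal (CoxRing k n))

end CoxRing

/-! ### Graded free modules -/

section Free

variable {k : Type v} [Field k] {r : ℕ} {n : Fin r → ℕ}

/-- The degree-`b` part of the graded free module `⨁ a, S(-deg a)`, whose underlying module is
`ι →₀ S`: the basis element `a` has degree `deg a`. -/
def freeGrading {ι : Type*} (deg : ι → Fin r → ℤ) (b : Fin r → ℤ) :
    AddSubgroup (ι →₀ CoxRing k n) where
  carrier := {f | ∀ a, f a ∈ coxGrading k n (b - deg a)}
  zero_mem' := fun _ => Submodule.zero_mem _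
  add_mem' := fun hf hg a => Submodule.add_mem _ (hf a) (hg a)
  neg_mem' := fun hf a => Submodule.neg_mem _ (hf a)

theorem single_mem_freeGrading {ι : Type*} (deg : ι → Fin r → ℤ) (a : ι) {c : Fin r → ℤ}
    {s : CoxRing k n} (hs : s ∈ coxGrading k n c) :
    Finsupp.single a s ∈ freeGrading deg (c + deg a) := by
  classical
  intro a'
  by_cases h : a = a'
  · subst h; simpa using hs
  · rw [Finsupp.single_eq_of_ne (Ne.symm h)]; exact Submodule.zero_mem _

instance freeGradedSMul {ι : Type*} (deg : ι → Fin r → ℤ) :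
    SetLike.GradedSMul (coxGrading k n) (freeGrading (k := k) (n := n) deg) where
  smul_mem := by
    intro i j s f hs hf a
    have h := SetLike.GradedMul.mul_mem hs (hf a)
    have e : (i +ᵥ j) - deg a = i + (j - deg a) := by rw [vadd_eq_add, add_sub_assoc]
    rw [e]
    exact h

/-- The inclusion of the degree-`c` part of the summand `S(-deg a)`. -/
noncomputable def freeSingle {ι : Type*} (deg : ι → Fin r → ℤ) (a : ι) (c : Fin r → ℤ) :
    coxGrading k n c →+ freeGrading (k := k) (n := n) deg (c + deg a) where
  toFun s := ⟨Finsupp.single a s.1, single_mem_freeGrading deg a s.2⟩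
  map_zero' := by ext1; simp
  map_add' x y := by ext1; simp

/-- The map splitting an element of a graded free module into homogeneous components. -/
noncomputable def freeDecomposeHom {ι : Type*} (deg : ι → Fin r → ℤ) :
    (ι →₀ CoxRing k n) →+ ⨁ b, freeGrading (k := k) (n := n) deg b :=
  Finsupp.liftAddHom fun a =>
    (DirectSum.toAddMonoid fun c =>
      (DirectSum.of (fun e => freeGrading (k := k) (n := n) deg e) (c + deg a)).comp
        (freeSingle deg a c)).comp
      (DirectSum.decomposeAddEquiv (coxGrading k n)).toAddMonoidHom

theorem freeDecomposeHom_single {ι : Type*} (deg : ι → Fin r → ℤ) (a : ι) {c b : Fin r → ℤ}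
    {s : CoxRing k n} (hs : s ∈ coxGrading k n c) (hb : c + deg a = b) :
    freeDecomposeHom deg (Finsupp.single a s) =
      DirectSum.of (fun e => freeGrading (k := k) (n := n) deg e) b
        ⟨Finsupp.single a s, hb ▸ single_mem_freeGrading deg a hs⟩ := by
  subst hb
  simp only [freeDecomposeHom, Finsupp.liftAddHom_apply_single, AddMonoidHom.comp_apply]
  erw [DirectSum.decompose_of_mem _ hs]
  rw [DirectSum.toAddMonoid_of]
  rfl

/-- A graded free module is the direct sum of its graded parts. -/
noncomputable instance freeDecomposition {ι : Type*} (deg : ι → Fin r → ℤ) :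
    DirectSum.Decomposition (freeGrading (k := k) (n := n) deg) :=
  DirectSum.Decomposition.ofAddHom _ (freeDecomposeHom deg)
    (by
      refine Finsupp.addHom_ext' fun a => AddMonoidHom.ext fun s => ?_
      induction s using DirectSum.Decomposition.inductionOn (coxGrading k n) with
      | zero => simp
      | homogeneous m =>
        simp only [AddMonoidHom.comp_apply, Finsupp.singleAddHom_apply, AddMonoidHom.id_apply]
        rw [freeDecomposeHom_single deg a m.2 rfl, DirectSum.coeAddMonoidHom_of]
      | add x y hx hy => rw [map_add, map_add, hx, hy])
    (by
      ext1 b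
      ext1 f
      obtain ⟨f, hf⟩ := f
      simp only [AddMonoidHom.comp_apply, DirectSum.coeAddMonoidHom_of, AddMonoidHom.id_apply]
      have key : ∀ t : Finset ι, ∀ h : (∑ a ∈ t, Finsupp.single a (f a)) ∈ freeGrading deg b,
          freeDecomposeHom deg (∑ a ∈ t, Finsupp.single a (f a)) =
            DirectSum.of (fun e => freeGrading (k := k) (n := n) deg e) b ⟨_, h⟩ := by
        classical
        intro t
        have hs : ∀ a, Finsupp.single a (f a) ∈ freeGrading (k := k) (n := n) deg b := by
          intro a
          have := single_mem_freeGrading deg a (hf a)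
          rwa [sub_add_cancel] at this
        induction t using Finset.induction_on with
        | empty =>
          intro h
          simp only [Finset.sum_empty, map_zero]
          exact (map_zero (DirectSum.of _ b)).symm
        | insert a t ha ih =>
          intro h
          have h' : (∑ a ∈ t, Finsupp.single a (f a)) ∈ freeGrading (k := k) (n := n) deg b :=
            sum_mem fun a _ => hs a
          simp only [Finset.sum_insert ha]
          rw [map_add, ih h', freeDecomposeHom_single deg a (hf a) (sub_add_cancel _ _),
            ← map_add]
          rfl
      have hsum : ∑ a ∈ f.support, Finsupp.single a (f a) = f := f.sum_single
      have h := key f.support (by rw [hsum]; exact hf)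
      simp only [hsum] at h
      exact h)

end Free

/-! ### Graded free resolutions -/

section Resolutions

variable {k : Type v} [Field k] {r : ℕ} {n : Fin r → ℕ}
  {M : Type u} [AddCommGroup M] [Module (CoxRing k n) M]

/-- A `ℤ^r`-graded free resolution `⋯ → F_1 → F_0 → M → 0` of a module `M` with graded parts `ℳ b`.
Its terms are `F_i = ⨁ a : ι i, S(-deg i a)`, with underlying module `ι i →₀ S`, and all maps
preserve degrees. -/
structure GradedFreeResolution (ℳ : (Fin r → ℤ) → AddSubgroup M) where
  /-- The index set of the chosen basis of `F_i`. -/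
  ι : ℕ → Type (max u v)
  /-- The degrees of the basis elements of `F_i`. -/
  deg : ∀ i, ι i → Fin r → ℤ
  /-- The differential `F_{i+1} → F_i`. -/
  d : ∀ i, (ι (i + 1) →₀ CoxRing k n) →ₗ[CoxRing k n] (ι i →₀ CoxRing k n)
  /-- The augmentation `F_0 → M`. -/
  aug : (ι 0 →₀ CoxRing k n) →ₗ[CoxRing k n] M
  d_mem : ∀ i b, ∀ f ∈ freeGrading (k := k) (n := n) (deg (i + 1)) b,
    d i f ∈ freeGrading (k := k) (n := n) (deg i) b
  aug_mem : ∀ b, ∀ f ∈ freeGrading (k := k) (n := n) (deg 0) b, aug f ∈ ℳ b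
  exact : ∀ i, Function.Exact (d (i + 1)) (d i)
  exact_aug : Function.Exact (d 0) aug
  aug_surjective : Function.Surjective aug

namespace GradedFreeResolution

variable {ℳ : (Fin r → ℤ) → AddSubgroup M} (F : GradedFreeResolution (k := k) (n := n) ℳ)

/-- `F_0` is generated in the single degree `d`, and every twist of `F_j` lies in `L_j(-d)`; the
twist of the summand `S(-b)` is `-b`. -/
def IsLinear (d : Fin r → ℤ) : Prop :=
  (∀ a, F.deg 0 a = d) ∧ ∀ j a, -(F.deg j a) ∈ regionL j (-d)

/-- `F_0` is generated in the single degree `d`, and every twist of `F_j` lies in `Q_j(-d)`. -/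
def IsQuasilinear (d : Fin r → ℤ) : Prop :=
  (∀ a, F.deg 0 a = d) ∧ ∀ j a, -(F.deg j a) ∈ regionQ j (-d)

/-- The `i`-th term of the complex `F ⊗ k`. -/
abbrev Tensor (i : ℕ) : Type (max u v) :=
  (F.ι i →₀ CoxRing k n) ⊗[CoxRing k n] ResidueField k n

/-- The differential of the complex `F ⊗ k`. -/
noncomputable def tensorD (i : ℕ) : F.Tensor (i + 1) →ₗ[CoxRing k n] F.Tensor i :=
  (F.d i).rTensor (ResidueField k n)

/-- The degree-`b` part of `F_i ⊗ k`; as `k` is concentrated in degree zero and generated by `1`,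
it consists of the elements `f ⊗ 1` with `f` of degree `b`. -/
noncomputable def tensorGrading (i : ℕ) (b : Fin r → ℤ) : AddSubgroup (F.Tensor i) :=
  (freeGrading (k := k) (n := n) (F.deg i) b).map
    ((TensorProduct.mk (CoxRing k n) _ (ResidueField k n)).flip 1).toAddMonoidHom

/-- The degree-`b` cycles of `F ⊗ k` in homological degree `i`. -/
noncomputable def cycles : (i : ℕ) → (Fin r → ℤ) → AddSubgroup (F.Tensor i)
  | 0, b => F.tensorGrading 0 b
  | i + 1, b => F.tensorGrading (i + 1) b ⊓ (F.tensorD i).toAddMonoidHom.ker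

/-- The degree-`b` boundaries of `F ⊗ k` in homological degree `i`. -/
noncomputable def boundaries (i : ℕ) (b : Fin r → ℤ) : AddSubgroup (F.Tensor i) :=
  (F.tensorGrading (i + 1) b).map (F.tensorD i).toAddMonoidHom

/-- The homology `H_i(F ⊗ k)_b`. -/
abbrev TensorHomology (i : ℕ) (b : Fin r → ℤ) : Type (max u v) :=
  F.cycles i b ⧸ (F.boundaries i b).addSubgroupOf (F.cycles i b)

end GradedFreeResolution

/-! ### Existence of graded free resolutions -/

/-- Every submodule with all homogeneous components is the image of a graded free module. -/
theorem exists_free_onto {N : Type w} [AddCommGroup N] [Module (CoxRing k n) N]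
    (𝒩 : (Fin r → ℤ) → AddSubgroup N) [DirectSum.Decomposition 𝒩]
    [SetLike.GradedSMul (coxGrading k n) 𝒩] (K : Submodule (CoxRing k n) N)
    (hK : ∀ b, ∀ x ∈ K, (DirectSum.decompose 𝒩 x b : N) ∈ K) :
    ∃ (ι : Type (max u v w)) (deg : ι → Fin r → ℤ)
      (f : (ι →₀ CoxRing k n) →ₗ[CoxRing k n] N),
      (∀ b, ∀ x ∈ freeGrading (k := k) (n := n) deg b, f x ∈ 𝒩 b) ∧ LinearMap.range f = K := by
  classical
  let ι := ULift.{max u v} (Σ b : Fin r → ℤ, {x : N // x ∈ 𝒩 b ∧ x ∈ K})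
  refine ⟨ι, fun a => a.down.1, Finsupp.linearCombination (CoxRing k n) fun a : ι => a.down.2.1, ?_, ?_⟩
  · intro b x hx
    rw [Finsupp.linearCombination_apply]
    refine sum_mem fun a _ => ?_
    have h := SetLike.GradedSMul.smul_mem (hx a) a.down.2.2.1
    rwa [vadd_eq_add, sub_add_cancel] at h
  · rw [Finsupp.range_linearCombination]
    apply le_antisymm
    · rw [Submodule.span_le]
      rintro _ ⟨a, rfl⟩
      exact a.down.2.2.2
    · intro x hx
      rw [← DirectSum.sum_support_decompose 𝒩 x]
      exact sum_mem fun b _ => Submodule.subset_span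
        ⟨⟨⟨b, _, SetLike.coe_mem _, hK b x hx⟩⟩, rfl⟩

/-- The kernel of a degree-preserving map contains the homogeneous components of its elements. -/
theorem decompose_mem_ker {N P : Type*} [AddCommGroup N] [Module (CoxRing k n) N]
    [AddCommGroup P] [Module (CoxRing k n) P]
    (𝒩 : (Fin r → ℤ) → AddSubgroup N) [DirectSum.Decomposition 𝒩]
    (𝒬 : (Fin r → ℤ) → AddSubgroup P) [DirectSum.Decomposition 𝒬]
    (f : N →ₗ[CoxRing k n] P) (hf : ∀ b, ∀ x ∈ 𝒩 b, f x ∈ 𝒬 b) :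
    ∀ b, ∀ x ∈ LinearMap.ker f, (DirectSum.decompose 𝒩 x b : N) ∈ LinearMap.ker f := by
  have key : ∀ b x, f (DirectSum.decompose 𝒩 x b : N) = DirectSum.decompose 𝒬 (f x) b := by
    intro b x
    induction x using DirectSum.Decomposition.inductionOn 𝒩 with
    | zero => simp
    | @homogeneous c m =>
      by_cases h : c = b
      · subst h
        rw [DirectSum.decompose_of_mem_same _ m.2,
          DirectSum.decompose_of_mem_same _ (hf _ _ m.2)]
      · rw [DirectSum.decompose_of_mem_ne _ m.2 h,
          DirectSum.decompose_of_mem_ne _ (hf _ _ m.2) h, map_zero]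
    | add x y hx hy =>
      simp only [DirectSum.decompose_add, DirectSum.add_apply, AddSubgroup.coe_add, map_add, hx, hy]
  intro b x hx
  rw [LinearMap.mem_ker] at hx ⊢
  rw [key, hx]
  simp

/-- A graded free module with a submodule containing the homogeneous components of its elements. -/
structure FreeStage (k : Type v) [Field k] {r : ℕ} (n : Fin r → ℕ) where
  /-- The index set of the basis. -/
  ι : Type (max u v)
  /-- The degrees of the basis elements. -/
  deg : ι → Fin r → ℤ
  /-- The submodule. -/
  K : Submodule (CoxRing k n) (ι →₀ CoxRing k n)
  mem : ∀ b, ∀ x ∈ K,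
    (DirectSum.decompose (freeGrading (k := k) (n := n) deg) x b : ι →₀ CoxRing k n) ∈ K

theorem FreeStage.exists_next (s : FreeStage.{u} k n) :
    ∃ (t : FreeStage.{u} k n) (f : (t.ι →₀ CoxRing k n) →ₗ[CoxRing k n] (s.ι →₀ CoxRing k n)),
      (∀ b, ∀ x ∈ freeGrading (k := k) (n := n) t.deg b,
        f x ∈ freeGrading (k := k) (n := n) s.deg b) ∧
      LinearMap.range f = s.K ∧ LinearMap.ker f = t.K := by
  obtain ⟨ι, deg, f, hf, hK⟩ := exists_free_onto.{u} (freeGrading s.deg) s.K s.mem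
  exact ⟨⟨ι, deg, LinearMap.ker f, decompose_mem_ker _ _ f hf⟩, f, hf, hK, rfl⟩

/-- Every graded module has a graded free resolution. -/
theorem nonempty_gradedFreeResolution (ℳ : (Fin r → ℤ) → AddSubgroup M)
    [DirectSum.Decomposition ℳ] [SetLike.GradedSMul (coxGrading k n) ℳ] :
    Nonempty (GradedFreeResolution (k := k) (n := n) ℳ) := by
  obtain ⟨ι, deg, f, hf, hK⟩ := exists_free_onto.{u} ℳ (⊤ : Submodule (CoxRing k n) M)
    fun _ _ _ => Submodule.mem_top
  choose next d hd hr hk using FreeStage.exists_next.{u} (k := k) (n := n)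
  let s : ℕ → FreeStage.{u} k n := fun i =>
    Nat.rec ⟨ι, deg, LinearMap.ker f, decompose_mem_ker _ _ f hf⟩ (fun _ t => next t) i
  refine ⟨{ ι := fun i => (s i).ι
            deg := fun i => (s i).deg
            d := fun i => d (s i)
            aug := f
            d_mem := fun i => hd (s i)
            aug_mem := hf
            exact := fun i => ?_
            exact_aug := ?_
            aug_surjective := LinearMap.range_eq_top.1 hK }⟩
  · exact LinearMap.exact_iff.2 ((hk (s i)).trans (hr (s (i + 1))).symm)
  · exact LinearMap.exact_iff.2 (hr (s 0)).symm

end Resolutions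

/-! ### Graded Tor and multigraded Betti degrees -/

section Betti

variable {k : Type v} [Field k] {r : ℕ} {n : Fin r → ℕ}
  {M : Type u} [AddCommGroup M] [Module (CoxRing k n) M]
  (ℳ : (Fin r → ℤ) → AddSubgroup M) [DirectSum.Decomposition ℳ]
  [SetLike.GradedSMul (coxGrading k n) ℳ]

/-- `Tor_i^S(M, k)_b`: the degree-`b` part of the `i`-th homology of `F ⊗ k`, for a graded free
resolution `F` of `M`. -/
abbrev GradedTor (i : ℕ) (b : Fin r → ℤ) : Type (max u v) :=
  (Classical.choice (nonempty_gradedFreeResolution (k := k) (n := n) ℳ)).TensorHomology i b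

/-- `β_i(M)`: the set of degrees `b` with `Tor_i^S(M, k)_b ≠ 0`. -/
def bettiDegrees (i : ℕ) : Set (Fin r → ℤ) :=
  {b | Nontrivial (GradedTor (k := k) (n := n) ℳ i b)}

end Betti

/-! ### Truncations -/

section Truncation

variable {k : Type v} [Field k] {r : ℕ} {n : Fin r → ℕ}
  {M : Type u} [AddCommGroup M] [Module (CoxRing k n) M]
  (ℳ : (Fin r → ℤ) → AddSubgroup M) [SetLike.GradedSMul (coxGrading k n) ℳ]

/-- The truncation `M_{≥ d}`, the sum of the graded parts of `M` in degrees at least `d`. -/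
def truncation (d : Fin r → ℤ) : Submodule (CoxRing k n) M where
  carrier := (⨆ b : Set.Ici d, ℳ b : AddSubgroup M)
  zero_mem' := AddSubgroup.zero_mem _
  add_mem' := AddSubgroup.add_mem _
  smul_mem' := by
    intro s m hm
    have hw : ∀ c : (Σ i : Fin r, Fin (n i + 1)) →₀ ℕ,
        0 ≤ Finsupp.weight (varDegree n) c := by
      intro c
      rw [Finsupp.weight_apply]
      refine Finset.sum_nonneg fun x _ => nsmul_nonneg ?_ _
      exact Pi.single_nonneg.2 zero_le_one
    simp only [SetLike.mem_coe] at hm ⊢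
    induction hm using AddSubgroup.iSup_induction' with
    | hp b m hm =>
      induction s using MvPolynomial.induction_on' with
      | monomial c a =>
        have h1 : MvPolynomial.monomial c a ∈
            coxGrading k n (Finsupp.weight (varDegree n) c) :=
          MvPolynomial.isWeightedHomogeneous_monomial _ _ _ rfl
        have h2 := SetLike.GradedSMul.smul_mem h1 hm
        exact AddSubgroup.mem_iSup_of_mem
          ⟨_, le_trans b.2 (le_add_of_nonneg_left (hw c))⟩ h2
      | add p q hp hq => rw [add_smul]; exact add_mem hp hq
    | h1 => rw [smul_zero]; exact zero_mem _
    | hadd x y _ _ hx hy => rw [smul_add]; exact add_mem hx hy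

/-- The grading of `M_{≥ d}` inherited from `M`. -/
noncomputable def truncationGrading (d b : Fin r → ℤ) : AddSubgroup (truncation (k := k) (n := n) ℳ d) :=
  (ℳ b).comap (truncation (k := k) (n := n) ℳ d).subtype.toAddMonoidHom

end Truncation

end Multigraded

/-! Write `𝔪` for the ideal of the variables. In a minimal graded free resolution of `M`, the
generators in homological degree `i` have degrees `c ∈ β_i(M)`. Truncation at `d` is exact, so
truncating term by term resolves `M_{≥d}` by modules `S(-c)_{≥d}`. Up to a twist such a module is a
monomial ideal with a linear resolution, whose generators in homological degree `j` have degrees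
`max(d, c) + l` with `|l| = j`. Iterated mapping cones give a resolution of `M_{≥d}` whose degrees
in step `i + j` are of the form `max(d, c) + l` with `c ∈ β_i(M)` and `|l| = j`. If `d` lies in
`L_i(c)` (or `Q_i(c)`), the negatives of these degrees lie in `L_{i+j}(-d)` (or `Q_{i+j}(-d)`):
`neg_max_add_mem_regionL`, `neg_max_add_mem_regionQ`.

The full cone is never assembled. For one degree `b` and one step `j`, `HasAvoidingRes` asks for a
resolution up to step `j` with no generator of degree `b` there. This passes to extensions and, with
a shift, to quotients (`HasAvoidingRes.extension`, `HasAvoidingRes.quotient`). Comparison with the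
minimal resolution of `M_{≥d}` then excludes `b` from its step `j` (`deg_ne_of_minimal_cover` for `j
= 0`, `deg_succ_ne_of_syzygyTorVanishes` for `j > 0`), so the minimal resolution is the linear or
quasilinear one. The same comparison shows that the degrees of the minimal resolution of `M` are
Betti degrees, although these are computed from an arbitrary resolution (`deg_mem_bettiDegrees`).
The linear resolutions come from `hasAvoidingRes_degreeUpperSet`, which adds one variable at a time.
-/

namespace Multigraded

/-! ### Graded maps and homogeneous submodules -/

section GradedMaps

variable {k : Type v} [Field k] {r : ℕ} {n : Fin r → ℕ}
  {N : Type*} [AddCommGroup N] [Module (CoxRing k n) N]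
  {P : Type*} [AddCommGroup P] [Module (CoxRing k n) P]

/-- A linear map preserving degrees. -/
def IsGradedMap (𝒩 : (Fin r → ℤ) → AddSubgroup N) (𝒬 : (Fin r → ℤ) → AddSubgroup P)
    (f : N →ₗ[CoxRing k n] P) : Prop :=
  ∀ b, ∀ x ∈ 𝒩 b, f x ∈ 𝒬 b

/-- A submodule containing the homogeneous components of its elements. -/
def IsHomogeneousSub (𝒩 : (Fin r → ℤ) → AddSubgroup N) [DirectSum.Decomposition 𝒩]
    (K : Submodule (CoxRing k n) N) : Prop :=
  ∀ b, ∀ x ∈ K, (DirectSum.decompose 𝒩 x b : N) ∈ K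

variable {𝒩 : (Fin r → ℤ) → AddSubgroup N} {𝒬 : (Fin r → ℤ) → AddSubgroup P}

theorem IsGradedMap.comp {L : Type*} [AddCommGroup L] [Module (CoxRing k n) L]
    {ℒ : (Fin r → ℤ) → AddSubgroup L} {g : P →ₗ[CoxRing k n] L} {f : N →ₗ[CoxRing k n] P}
    (hg : IsGradedMap 𝒬 ℒ g) (hf : IsGradedMap 𝒩 𝒬 f) : IsGradedMap 𝒩 ℒ (g ∘ₗ f) :=
  fun b x hx => hg b _ (hf b x hx)

theorem IsGradedMap.id : IsGradedMap 𝒩 𝒩 (LinearMap.id : N →ₗ[CoxRing k n] N) :=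
  fun _ _ hx => hx

theorem IsGradedMap.sub {f g : N →ₗ[CoxRing k n] P}
    (hf : IsGradedMap 𝒩 𝒬 f) (hg : IsGradedMap 𝒩 𝒬 g) : IsGradedMap 𝒩 𝒬 (f - g) :=
  fun b x hx => AddSubgroup.sub_mem _ (hf b x hx) (hg b x hx)

theorem IsGradedMap.decompose [DirectSum.Decomposition 𝒩] [DirectSum.Decomposition 𝒬]
    {f : N →ₗ[CoxRing k n] P} (hf : IsGradedMap 𝒩 𝒬 f) (b : Fin r → ℤ) (x : N) :
    (DirectSum.decompose 𝒬 (f x) b : P) = f (DirectSum.decompose 𝒩 x b : N) := by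
  induction x using DirectSum.Decomposition.inductionOn 𝒩 with
  | zero => simp
  | @homogeneous c m =>
    by_cases h : c = b
    · subst h
      rw [DirectSum.decompose_of_mem_same _ m.2,
        DirectSum.decompose_of_mem_same _ (hf _ _ m.2)]
    · rw [DirectSum.decompose_of_mem_ne _ m.2 h,
        DirectSum.decompose_of_mem_ne _ (hf _ _ m.2) h, map_zero]
  | add x y hx hy =>
    simp only [DirectSum.decompose_add, DirectSum.add_apply, AddSubgroup.coe_add, map_add, hx, hy]

theorem IsGradedMap.isHomogeneousSub_ker [DirectSum.Decomposition 𝒩] [DirectSum.Decomposition 𝒬]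
    {f : N →ₗ[CoxRing k n] P} (hf : IsGradedMap 𝒩 𝒬 f) :
    IsHomogeneousSub 𝒩 (LinearMap.ker f) :=
  decompose_mem_ker 𝒩 𝒬 f hf

theorem IsHomogeneousSub.top [DirectSum.Decomposition 𝒩] :
    IsHomogeneousSub 𝒩 (⊤ : Submodule (CoxRing k n) N) :=
  fun _ _ _ => Submodule.mem_top

/-- A homogeneous element of the image of a homogeneous submodule has a homogeneous preimage. -/
theorem IsGradedMap.exists_homogeneous [DirectSum.Decomposition 𝒩] [DirectSum.Decomposition 𝒬]
    {f : N →ₗ[CoxRing k n] P} (hf : IsGradedMap 𝒩 𝒬 f) {B : Submodule (CoxRing k n) N}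
    (hB : IsHomogeneousSub 𝒩 B) {b : Fin r → ℤ} {y : P} (hy : y ∈ 𝒬 b) (hyB : y ∈ B.map f) :
    ∃ x ∈ B, x ∈ 𝒩 b ∧ f x = y := by
  obtain ⟨x, hx, rfl⟩ := hyB
  -- The degree-`b` component of any preimage works, since graded maps commute with taking
  -- components.
  exact ⟨_, hB b x hx, SetLike.coe_mem _, by
    rw [← hf.decompose, DirectSum.decompose_of_mem_same _ hy]⟩

theorem single_one_mem_freeGrading {ι : Type*} (deg : ι → Fin r → ℤ) (a : ι) :
    Finsupp.single a (1 : CoxRing k n) ∈ freeGrading (k := k) (n := n) deg (deg a) := by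
  have h := single_mem_freeGrading (k := k) (n := n) deg a
    (MvPolynomial.isWeightedHomogeneous_one k (varDegree n))
  rwa [zero_add] at h

theorem isGradedMap_linearCombination [SetLike.GradedSMul (coxGrading k n) 𝒩] {ι : Type*}
    (deg : ι → Fin r → ℤ) (x : ι → N) (hx : ∀ a, x a ∈ 𝒩 (deg a)) :
    IsGradedMap (freeGrading (k := k) (n := n) deg) 𝒩
      (Finsupp.linearCombination (CoxRing k n) x) := by
  intro b y hy
  rw [Finsupp.linearCombination_apply]
  refine sum_mem fun a _ => ?_
  have h := SetLike.GradedSMul.smul_mem (hy a) (hx a)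
  rwa [vadd_eq_add, sub_add_cancel] at h

/-- Graded free modules are projective in the graded sense. -/
theorem exists_graded_lift [DirectSum.Decomposition 𝒩] [DirectSum.Decomposition 𝒬]
    [SetLike.GradedSMul (coxGrading k n) 𝒩] {ι : Type*} {deg : ι → Fin r → ℤ}
    {g : (ι →₀ CoxRing k n) →ₗ[CoxRing k n] P} (hg : IsGradedMap (freeGrading deg) 𝒬 g)
    {p : N →ₗ[CoxRing k n] P} (hp : IsGradedMap 𝒩 𝒬 p) {B : Submodule (CoxRing k n) N}
    (hB : IsHomogeneousSub 𝒩 B) (h : LinearMap.range g ≤ B.map p) :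
    ∃ f : (ι →₀ CoxRing k n) →ₗ[CoxRing k n] N, IsGradedMap (freeGrading deg) 𝒩 f ∧
      LinearMap.range f ≤ B ∧ p ∘ₗ f = g := by
  have key : ∀ a, ∃ x ∈ B, x ∈ 𝒩 (deg a) ∧ p x = g (Finsupp.single a 1) := fun a =>
    hp.exists_homogeneous hB (hg _ _ (single_one_mem_freeGrading deg a)) (h ⟨_, rfl⟩)
  choose x hxB hx hpx using key
  refine ⟨Finsupp.linearCombination _ x, isGradedMap_linearCombination deg x hx, ?_, ?_⟩
  · rw [Finsupp.range_linearCombination, Submodule.span_le]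
    rintro _ ⟨a, rfl⟩
    exact hxB a
  · refine Finsupp.lhom_ext' fun a => LinearMap.ext_ring ?_
    simp [hpx]

end GradedMaps

/-! ### Partial resolutions without generators of a given degree -/

section Syzygies

variable {k : Type v} [Field k] {r : ℕ} {n : Fin r → ℕ}
  {N : Type*} [AddCommGroup N] [Module (CoxRing k n) N]
  {P : Type*} [AddCommGroup P] [Module (CoxRing k n) P]

variable (k n) in
/-- The submodule `K` of the graded free module `F_0` on `deg` is the kernel of the augmentation of
a graded free resolution whose `j`-th term has no generator of degree `b`. -/
def ResolvesAvoiding (b : Fin r → ℤ) : ℕ → ∀ (ι : Type w) (_ : ι → Fin r → ℤ)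
    (_ : Submodule (CoxRing k n) (ι →₀ CoxRing k n)), Prop
  -- The last submodule is left unconstrained: the resolution stops at the term under inspection.
  | 0, _, deg, _ => ∀ a, deg a ≠ b
  | j + 1, ι, deg, K => ∃ (κ : Type w) (deg' : κ → Fin r → ℤ)
      (f : (κ →₀ CoxRing k n) →ₗ[CoxRing k n] (ι →₀ CoxRing k n)),
      IsGradedMap (freeGrading deg') (freeGrading deg) f ∧ LinearMap.range f = K ∧
        ResolvesAvoiding b j κ deg' (LinearMap.ker f)

/-- The submodule `K` has a graded free resolution whose `j`-th term has no generator of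
degree `b`. -/
def HasAvoidingRes (b : Fin r → ℤ) (j : ℕ) (𝒩 : (Fin r → ℤ) → AddSubgroup N)
    (K : Submodule (CoxRing k n) N) : Prop :=
  ∃ (κ : Type w) (deg : κ → Fin r → ℤ) (f : (κ →₀ CoxRing k n) →ₗ[CoxRing k n] N),
    IsGradedMap (freeGrading deg) 𝒩 f ∧ LinearMap.range f = K ∧
      ResolvesAvoiding.{v, w} k n b j κ deg (LinearMap.ker f)

variable {b : Fin r → ℤ} {𝒩 : (Fin r → ℤ) → AddSubgroup N} {𝒬 : (Fin r → ℤ) → AddSubgroup P}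

theorem resolvesAvoiding_pempty (j : ℕ) (deg : PEmpty.{w + 1} → Fin r → ℤ)
    (K : Submodule (CoxRing k n) (PEmpty.{w + 1} →₀ CoxRing k n)) :
    ResolvesAvoiding.{v, w} k n b j PEmpty deg K := by
  induction j generalizing deg K with
  | zero => exact fun a => a.elim
  | succ j ih =>
    exact ⟨PEmpty, fun a => a.elim, 0, fun _ _ _ => AddSubgroup.zero_mem _,
      Subsingleton.elim _ _, ih _ _⟩

theorem hasAvoidingRes_bot (j : ℕ) :
    HasAvoidingRes.{v, w} b j 𝒩 (⊥ : Submodule (CoxRing k n) N) :=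
  ⟨PEmpty, fun a => a.elim, 0, fun _ _ _ => AddSubgroup.zero_mem _, LinearMap.range_zero,
    resolvesAvoiding_pempty _ _ _⟩

/-- As `g` is injective on `K`, composing the cover of `K` with `g` leaves its kernel unchanged, so
the higher terms can be kept. -/
theorem HasAvoidingRes.map_injOn {j : ℕ} {K : Submodule (CoxRing k n) N}
    (h : HasAvoidingRes.{v, w} b j 𝒩 K) {g : N →ₗ[CoxRing k n] P} (hg : IsGradedMap 𝒩 𝒬 g)
    (hK : K ⊓ LinearMap.ker g = ⊥) : HasAvoidingRes.{v, w} b j 𝒬 (K.map g) := by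
  obtain ⟨κ, deg, f, hf, rfl, hr⟩ := h
  refine ⟨κ, deg, g ∘ₗ f, hg.comp hf, LinearMap.range_comp f g, ?_⟩
  have : LinearMap.ker (g ∘ₗ f) = LinearMap.ker f := by
    refine le_antisymm (fun x hx => ?_) (fun x hx => ?_)
    · have : f x ∈ LinearMap.range f ⊓ LinearMap.ker g := ⟨⟨x, rfl⟩, hx⟩
      rwa [hK, Submodule.mem_bot] at this
    · rw [LinearMap.mem_ker] at hx ⊢
      rw [LinearMap.comp_apply, hx, map_zero]
  rwa [this]

/-- At step zero only the generators count, so `g` may have any kernel. -/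
theorem HasAvoidingRes.map_zero {K : Submodule (CoxRing k n) N}
    (h : HasAvoidingRes.{v, w} b 0 𝒩 K) {g : N →ₗ[CoxRing k n] P} (hg : IsGradedMap 𝒩 𝒬 g) :
    HasAvoidingRes.{v, w} b 0 𝒬 (K.map g) := by
  obtain ⟨κ, deg, f, hf, rfl, hr⟩ := h
  exact ⟨κ, deg, g ∘ₗ f, hg.comp hf, LinearMap.range_comp f g, hr⟩

/-! ### Direct sums of two graded free modules -/

section Sum

variable {κ₁ κ₂ : Type w} (deg₁ : κ₁ → Fin r → ℤ) (deg₂ : κ₂ → Fin r → ℤ)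

/-- The inclusion of the first summand of `F_1 ⊕ F_2`. -/
noncomputable def freeInl :
    (κ₁ →₀ CoxRing k n) →ₗ[CoxRing k n] (κ₁ ⊕ κ₂ →₀ CoxRing k n) :=
  Finsupp.lmapDomain _ _ Sum.inl

/-- The projection to the first summand of `F_1 ⊕ F_2`. -/
noncomputable def freeFst :
    (κ₁ ⊕ κ₂ →₀ CoxRing k n) →ₗ[CoxRing k n] (κ₁ →₀ CoxRing k n) :=
  LinearMap.fst _ _ _ ∘ₗ (Finsupp.sumFinsuppLEquivProdFinsupp (CoxRing k n)).toLinearMap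

/-- The projection to the second summand of `F_1 ⊕ F_2`. -/
noncomputable def freeSnd :
    (κ₁ ⊕ κ₂ →₀ CoxRing k n) →ₗ[CoxRing k n] (κ₂ →₀ CoxRing k n) :=
  LinearMap.snd _ _ _ ∘ₗ (Finsupp.sumFinsuppLEquivProdFinsupp (CoxRing k n)).toLinearMap

theorem isGradedMap_freeInl : IsGradedMap (freeGrading (k := k) (n := n) deg₁)
    (freeGrading (Sum.elim deg₁ deg₂)) freeInl := by
  rintro b x hx (a | a)
  · simpa [freeInl, Finsupp.mapDomain_apply Sum.inl_injective] using hx a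
  · have : Finsupp.mapDomain Sum.inl x (Sum.inr a : κ₁ ⊕ κ₂) = 0 :=
      Finsupp.mapDomain_of_notMem_range _ _ (by simp)
    simp only [freeInl, Finsupp.lmapDomain_apply, this]
    exact Submodule.zero_mem _

theorem isGradedMap_freeFst : IsGradedMap (freeGrading (k := k) (n := n) (Sum.elim deg₁ deg₂))
    (freeGrading deg₁) freeFst :=
  fun _ _ hx a => hx (Sum.inl a)

theorem isGradedMap_freeSnd : IsGradedMap (freeGrading (k := k) (n := n) (Sum.elim deg₁ deg₂))
    (freeGrading deg₂) freeSnd :=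
  fun _ _ hx a => hx (Sum.inr a)

theorem exists_freeFst_freeSnd (x : κ₁ →₀ CoxRing k n) (y : κ₂ →₀ CoxRing k n) :
    ∃ z : κ₁ ⊕ κ₂ →₀ CoxRing k n, freeFst z = x ∧ freeSnd z = y :=
  ⟨(Finsupp.sumFinsuppLEquivProdFinsupp (CoxRing k n)).symm (x, y), by simp [freeFst],
    by simp [freeSnd]⟩

theorem freeFst_freeInl (x : κ₁ →₀ CoxRing k n) : freeFst (freeInl (κ₂ := κ₂) x) = x := by
  ext1 a
  exact Finsupp.mapDomain_apply Sum.inl_injective _ _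

theorem freeSnd_freeInl (x : κ₁ →₀ CoxRing k n) : freeSnd (freeInl (κ₂ := κ₂) x) = 0 := by
  ext1 a
  exact Finsupp.mapDomain_of_notMem_range _ _ (by simp)

theorem freeInl_freeFst {z : κ₁ ⊕ κ₂ →₀ CoxRing k n} (hz : freeSnd z = 0) :
    freeInl (freeFst z) = z := by
  ext1 a
  rcases a with a | a
  · exact DFunLike.congr_fun (freeFst_freeInl (κ₂ := κ₂) (freeFst z)) a
  · exact (DFunLike.congr_fun (freeSnd_freeInl (κ₂ := κ₂) (freeFst z)) a).trans
      (DFunLike.congr_fun hz a).symm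

end Sum

/-- The horseshoe construction for one step of a resolution. -/
theorem exists_horseshoe [DirectSum.Decomposition 𝒩] [DirectSum.Decomposition 𝒬]
    [SetLike.GradedSMul (coxGrading k n) 𝒩]
    {g : N →ₗ[CoxRing k n] P} (hg : IsGradedMap 𝒩 𝒬 g) {B : Submodule (CoxRing k n) N}
    (hB : IsHomogeneousSub 𝒩 B) {κ₁ κ₂ : Type w} {deg₁ : κ₁ → Fin r → ℤ} {deg₂ : κ₂ → Fin r → ℤ}
    {f₁ : (κ₁ →₀ CoxRing k n) →ₗ[CoxRing k n] N} (hf₁ : IsGradedMap (freeGrading deg₁) 𝒩 f₁)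
    (hr₁ : LinearMap.range f₁ = B ⊓ LinearMap.ker g)
    {f₂ : (κ₂ →₀ CoxRing k n) →ₗ[CoxRing k n] P} (hf₂ : IsGradedMap (freeGrading deg₂) 𝒬 f₂)
    (hr₂ : LinearMap.range f₂ = B.map g) :
    ∃ f : (κ₁ ⊕ κ₂ →₀ CoxRing k n) →ₗ[CoxRing k n] N,
      IsGradedMap (freeGrading (Sum.elim deg₁ deg₂)) 𝒩 f ∧ LinearMap.range f = B ∧
      LinearMap.ker f ⊓ LinearMap.ker freeSnd = (LinearMap.ker f₁).map freeInl ∧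
      (LinearMap.ker f).map freeSnd = LinearMap.ker f₂ := by
  -- Projectivity lifts `f₂` through `g` to a map `l` into `B`; the cover is then `f₁` on the first
  -- summand and `l` on the second.
  obtain ⟨l, hl, hlB, hgl⟩ := exists_graded_lift hf₂ hg hB hr₂.le
  have hgl' : ∀ y, g (l y) = f₂ y := fun y => LinearMap.congr_fun hgl y
  have hf₁' : ∀ x, f₁ x ∈ B ∧ g (f₁ x) = 0 := fun x => by
    have : f₁ x ∈ B ⊓ LinearMap.ker g := hr₁ ▸ ⟨x, rfl⟩
    exact this
  have hl' : ∀ y, l y ∈ B := fun y => hlB ⟨y, rfl⟩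
  refine ⟨f₁ ∘ₗ freeFst + l ∘ₗ freeSnd, fun b x hx => AddSubgroup.add_mem _
    (hf₁ _ _ (isGradedMap_freeFst deg₁ deg₂ b x hx))
    (hl _ _ (isGradedMap_freeSnd deg₁ deg₂ b x hx)), le_antisymm ?_ ?_, le_antisymm ?_ ?_,
    le_antisymm ?_ ?_⟩
  · rintro _ ⟨z, rfl⟩
    exact B.add_mem (hf₁' _).1 (hl' _)
  · intro x hx
    obtain ⟨y, hy⟩ : g x ∈ LinearMap.range f₂ := hr₂ ▸ ⟨x, hx, rfl⟩
    obtain ⟨y', hy'⟩ : x - l y ∈ LinearMap.range f₁ :=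
      hr₁ ▸ ⟨B.sub_mem hx (hl' y), by simp [hgl', hy]⟩
    obtain ⟨z, rfl, rfl⟩ := exists_freeFst_freeSnd y' y
    exact ⟨z, by simp [hy']⟩
  · rintro z ⟨hz, hz'⟩
    replace hz' : freeSnd z = 0 := hz'
    refine ⟨freeFst z, ?_, freeInl_freeFst hz'⟩
    simpa [hz'] using hz
  · rintro _ ⟨x, hx, rfl⟩
    have hx' : f₁ x = 0 := hx
    refine ⟨?_, freeSnd_freeInl x⟩
    simp [freeSnd_freeInl, freeFst_freeInl, hx']
  · rintro _ ⟨z, hz, rfl⟩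
    have hz' : f₁ (freeFst z) + l (freeSnd z) = 0 := hz
    have := congrArg g hz'
    simpa [(hf₁' _).2, hgl'] using this
  · intro y hy
    have hy' : f₂ y = 0 := hy
    -- If `f₂ y = 0`, then `l y` lies in `B ⊓ ker g`, the range of `f₁`, so a first coordinate can
    -- cancel it.
    obtain ⟨y', hy'⟩ : - l y ∈ LinearMap.range f₁ :=
      hr₁ ▸ ⟨B.neg_mem (hl' y), by simp [hgl', hy']⟩
    obtain ⟨z, rfl, rfl⟩ := exists_freeFst_freeSnd y' y
    exact ⟨z, by simp [hy'], rfl⟩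

theorem freeInl_injective {κ₁ κ₂ : Type w} :
    Function.Injective (freeInl : (κ₁ →₀ CoxRing k n) →ₗ[_] (κ₁ ⊕ κ₂ →₀ CoxRing k n)) :=
  Function.LeftInverse.injective freeFst_freeInl

/-- The kernel produced by one horseshoe step is again an extension of the two kernels, so the step
iterates. The generators of the `j`-th term are a disjoint union and still avoid `b`. -/
theorem ResolvesAvoiding.horseshoe {j : ℕ} {κ₁ κ₂ : Type w} {deg₁ : κ₁ → Fin r → ℤ}
    {deg₂ : κ₂ → Fin r → ℤ} {K₁ : Submodule (CoxRing k n) (κ₁ →₀ CoxRing k n)}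
    {K₂ : Submodule (CoxRing k n) (κ₂ →₀ CoxRing k n)}
    {K : Submodule (CoxRing k n) (κ₁ ⊕ κ₂ →₀ CoxRing k n)}
    (hK : IsHomogeneousSub (freeGrading (Sum.elim deg₁ deg₂)) K)
    (hK₁ : K ⊓ LinearMap.ker freeSnd = K₁.map freeInl) (hK₂ : K.map freeSnd = K₂)
    (h₁ : ResolvesAvoiding.{v, w} k n b j κ₁ deg₁ K₁)
    (h₂ : ResolvesAvoiding.{v, w} k n b j κ₂ deg₂ K₂) :
    ResolvesAvoiding.{v, w} k n b j (κ₁ ⊕ κ₂) (Sum.elim deg₁ deg₂) K := by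
  induction j generalizing κ₁ κ₂ with
  | zero => exact Sum.rec h₁ h₂
  | succ j ih =>
    obtain ⟨κ₁', deg₁', f₁, hf₁, hr₁, h₁⟩ := h₁
    obtain ⟨κ₂', deg₂', f₂, hf₂, hr₂, h₂⟩ := h₂
    obtain ⟨f, hf, hr, hk, hm⟩ := exists_horseshoe (isGradedMap_freeSnd deg₁ deg₂) hK
      ((isGradedMap_freeInl deg₁ deg₂).comp hf₁) (by rw [LinearMap.range_comp, hr₁, hK₁])
      hf₂ (hr₂.trans hK₂.symm)
    refine ⟨_, _, f, hf, hr, ih hf.isHomogeneousSub_ker ?_ hm h₁ h₂⟩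
    rw [hk, LinearMap.ker_comp_of_ker_eq_bot _ (LinearMap.ker_eq_bot.2 freeInl_injective)]

/-- Extensions of modules having suitable resolutions have suitable resolutions. -/
theorem HasAvoidingRes.extension {j : ℕ} [DirectSum.Decomposition 𝒩] [DirectSum.Decomposition 𝒬]
    [SetLike.GradedSMul (coxGrading k n) 𝒩]
    {g : N →ₗ[CoxRing k n] P} (hg : IsGradedMap 𝒩 𝒬 g) {B : Submodule (CoxRing k n) N}
    (hB : IsHomogeneousSub 𝒩 B) (h₁ : HasAvoidingRes.{v, w} b j 𝒩 (B ⊓ LinearMap.ker g))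
    (h₂ : HasAvoidingRes.{v, w} b j 𝒬 (B.map g)) : HasAvoidingRes.{v, w} b j 𝒩 B := by
  obtain ⟨κ₁, deg₁, f₁, hf₁, hr₁, h₁⟩ := h₁
  obtain ⟨κ₂, deg₂, f₂, hf₂, hr₂, h₂⟩ := h₂
  obtain ⟨f, hf, hr, hk, hm⟩ := exists_horseshoe hg hB hf₁ hr₁ hf₂ hr₂
  exact ⟨_, _, f, hf, hr, .horseshoe hf.isHomogeneousSub_ker hk hm h₁ h₂⟩

/-- The mapping cone: quotients of modules having suitable resolutions have suitable
resolutions. -/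
theorem HasAvoidingRes.quotient {j : ℕ} [DirectSum.Decomposition 𝒩] [DirectSum.Decomposition 𝒬]
    [SetLike.GradedSMul (coxGrading k n) 𝒩]
    {g : N →ₗ[CoxRing k n] P} (hg : IsGradedMap 𝒩 𝒬 g) {B : Submodule (CoxRing k n) N}
    (h₁ : HasAvoidingRes.{v, w} b (j + 1) 𝒩 B)
    (h₂ : HasAvoidingRes.{v, w} b j 𝒩 (B ⊓ LinearMap.ker g)) :
    HasAvoidingRes.{v, w} b (j + 1) 𝒬 (B.map g) := by
  obtain ⟨κ, deg, f, hf, rfl, h₁⟩ := h₁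
  refine ⟨κ, deg, g ∘ₗ f, hg.comp hf, LinearMap.range_comp f g, ?_⟩
  -- The map `f` sends `ker (g ∘ f)` onto `B ⊓ ker g` with kernel `ker f`. Both ends have suitable
  -- resolutions up to step `j`, the one of `ker f` being that of `B` with its first term removed.
  refine HasAvoidingRes.extension hf (hg.comp hf).isHomogeneousSub_ker ?_ ?_
  · have : LinearMap.ker (g ∘ₗ f) ⊓ LinearMap.ker f = LinearMap.ker f :=
      inf_eq_right.2 (LinearMap.ker_le_ker_comp f g)
    rw [this]
    exact h₁
  · rwa [LinearMap.ker_comp, Submodule.map_comap_eq]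

end Syzygies

/-! ### The irrelevant ideal -/

section Irrelevant

variable (k : Type v) [Field k] {r : ℕ} (n : Fin r → ℕ)

/-- The ideal generated by all variables. -/
noncomputable abbrev varIdeal : Ideal (CoxRing k n) := Ideal.span (Set.range MvPolynomial.X)

variable {k n}

theorem mem_varIdeal_iff {s : CoxRing k n} :
    s ∈ varIdeal k n ↔ MvPolynomial.constantCoeff s = 0 := by
  rw [varIdeal, ← Set.image_univ, MvPolynomial.mem_ideal_span_X_image,
    MvPolynomial.constantCoeff_eq]
  constructor
  · intro h
    by_contra h0
    obtain ⟨i, -, hi⟩ := h 0 (MvPolynomial.mem_support_iff.2 h0)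
    exact hi rfl
  · intro h u hu
    have : u ≠ 0 := by
      rintro rfl
      exact MvPolynomial.mem_support_iff.1 hu h
    obtain ⟨i, hi⟩ := Finsupp.ne_iff.1 this
    exact ⟨i, Set.mem_univ _, hi⟩

theorem weight_varDegree_apply (u : (Σ i : Fin r, Fin (n i + 1)) →₀ ℕ) (i : Fin r) :
    Finsupp.weight (varDegree n) u i = ∑ x, if x.1 = i then (u x : ℤ) else 0 := by
  rw [Finsupp.weight_apply, Finsupp.sum_fintype _ _ (by simp), Finset.sum_apply]
  refine Finset.sum_congr rfl fun x _ => ?_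
  by_cases h : x.1 = i
  · subst h
    simp [varDegree]
  · simp [varDegree, h, Ne.symm h]

/-- Every variable contributes positively to one coordinate and nothing cancels. Hence the
degree-zero part of `S` is the field, which is what makes minimal covers behave as over a local
ring. -/
theorem weight_varDegree_eq_zero {u : (Σ i : Fin r, Fin (n i + 1)) →₀ ℕ}
    (hu : Finsupp.weight (varDegree n) u = 0) : u = 0 := by
  ext x
  have h := congrFun hu x.1
  rw [weight_varDegree_apply, Pi.zero_apply, Finset.sum_eq_zero_iff_of_nonneg] at h
  · simpa using h x (Finset.mem_univ _)
  · intro y _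
    split_ifs <;> simp

theorem mem_varIdeal_of_mem_coxGrading {s : CoxRing k n} {c : Fin r → ℤ}
    (hs : s ∈ coxGrading k n c) (hc : c ≠ 0) : s ∈ varIdeal k n := by
  rw [mem_varIdeal_iff, MvPolynomial.constantCoeff_eq]
  by_contra h
  exact hc (by simpa using (hs h).symm)

theorem eq_C_of_mem_coxGrading_zero {s : CoxRing k n} (hs : s ∈ coxGrading k n 0) :
    s = MvPolynomial.C (MvPolynomial.constantCoeff s) := by
  ext u
  rw [MvPolynomial.coeff_C, MvPolynomial.constantCoeff_eq]
  split_ifs with h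
  · rw [h]
  · by_contra h0
    exact h (weight_varDegree_eq_zero (hs h0)).symm

theorem mem_smul_top_iff {ι : Type*} (I : Ideal (CoxRing k n)) (f : ι →₀ CoxRing k n) :
    f ∈ I • (⊤ : Submodule (CoxRing k n) (ι →₀ CoxRing k n)) ↔ ∀ a, f a ∈ I := by
  constructor
  · intro hf a
    induction hf using Submodule.smul_induction_on' with
    | smul s hs g _ => exact I.mul_mem_right _ hs
    | add g _ g' _ hg hg' => exact I.add_mem hg hg'
  · intro hf
    rw [← f.sum_single]
    refine sum_mem fun a _ => ?_
    rw [← mul_one (f a), ← smul_eq_mul, ← Finsupp.smul_single]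
    exact Submodule.smul_mem_smul (hf a) Submodule.mem_top

/-- Each coefficient has nonzero degree `b - deg a` and so no constant term: the free module
tensored with the residue field vanishes in degree `b`. -/
theorem mem_varIdeal_smul_top_of_ne {ι : Type*} {deg : ι → Fin r → ℤ} {b : Fin r → ℤ}
    (hb : ∀ a, deg a ≠ b) {f : ι →₀ CoxRing k n} (hf : f ∈ freeGrading deg b) :
    f ∈ varIdeal k n • (⊤ : Submodule (CoxRing k n) (ι →₀ CoxRing k n)) :=
  (mem_smul_top_iff _ _).2 fun a =>
    mem_varIdeal_of_mem_coxGrading (hf a) (sub_ne_zero.2 (hb a).symm)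

theorem single_one_notMem_varIdeal_smul_top {ι : Type*} (a : ι) :
    Finsupp.single a (1 : CoxRing k n) ∉
      varIdeal k n • (⊤ : Submodule (CoxRing k n) (ι →₀ CoxRing k n)) := by
  intro h
  have := (mem_smul_top_iff _ _).1 h a
  simp [mem_varIdeal_iff] at this

end Irrelevant

/-! ### Minimal covers -/

section MinimalCovers

variable {k : Type v} [Field k] {r : ℕ} {n : Fin r → ℕ}
  {N : Type*} [AddCommGroup N] [Module (CoxRing k n) N]
  {𝒩 : (Fin r → ℤ) → AddSubgroup N}

theorem exists_finset_homogeneous [DirectSum.Decomposition 𝒩] {K : Submodule (CoxRing k n) N}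
    (hK : IsHomogeneousSub 𝒩 K) (hfg : K.FG) :
    ∃ t : Finset N, (∀ x ∈ t, ∃ b, x ∈ 𝒩 b) ∧ Submodule.span (CoxRing k n) (t : Set N) = K := by
  classical
  obtain ⟨s, rfl⟩ := hfg
  refine ⟨s.biUnion fun x => (DirectSum.decompose 𝒩 x).support.image
    fun b => (DirectSum.decompose 𝒩 x b : N), ?_, le_antisymm ?_ ?_⟩
  · intro y hy
    simp only [Finset.mem_biUnion, Finset.mem_image] at hy
    obtain ⟨x, -, b, -, rfl⟩ := hy
    exact ⟨b, SetLike.coe_mem _⟩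
  · rw [Submodule.span_le]
    intro y hy
    simp only [Finset.mem_coe, Finset.mem_biUnion, Finset.mem_image] at hy
    obtain ⟨x, hx, b, -, rfl⟩ := hy
    exact hK b x (Submodule.subset_span hx)
  · rw [Submodule.span_le]
    intro x hx
    rw [SetLike.mem_coe, ← DirectSum.sum_support_decompose 𝒩 x]
    refine sum_mem fun b hb => Submodule.subset_span ?_
    simp only [Finset.mem_coe, Finset.mem_biUnion, Finset.mem_image]
    exact ⟨x, hx, b, hb, rfl⟩

/-- Finitely generated homogeneous submodules have minimal graded free covers. -/
theorem exists_minimal_cover [DirectSum.Decomposition 𝒩] [SetLike.GradedSMul (coxGrading k n) 𝒩]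
    {K : Submodule (CoxRing k n) N} (hK : IsHomogeneousSub 𝒩 K) (hfg : K.FG) :
    ∃ (ι : Type w) (_ : Finite ι) (deg : ι → Fin r → ℤ)
      (f : (ι →₀ CoxRing k n) →ₗ[CoxRing k n] N), IsGradedMap (freeGrading deg) 𝒩 f ∧
      LinearMap.range f = K ∧ LinearMap.ker f ≤ varIdeal k n • ⊤ := by
  classical
  -- A homogeneous generating set of least cardinality gives the minimal cover.
  have hex : ∃ m, ∃ t : Finset N, t.card = m ∧ (∀ x ∈ t, ∃ b, x ∈ 𝒩 b) ∧
      Submodule.span (CoxRing k n) (t : Set N) = K := by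
    obtain ⟨t, h⟩ := exists_finset_homogeneous hK hfg
    exact ⟨_, t, rfl, h⟩
  obtain ⟨t, hcard, ht, hspan⟩ := Nat.find_spec hex
  have hmin : ∀ x ∈ t, x ∉ Submodule.span (CoxRing k n) ((t.erase x : Finset N) : Set N) := by
    intro x hx hxs
    refine Nat.find_min hex (m := (t.erase x).card) ?_ ⟨t.erase x, rfl,
      fun y hy => ht y (Finset.mem_of_mem_erase hy), ?_⟩
    · rw [← hcard]
      exact Finset.card_erase_lt_of_mem hx
    · rw [← hspan, ← Submodule.span_insert_eq_span hxs, ← Finset.coe_insert,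
        Finset.insert_erase hx]
  let e : ULift.{w} (Fin t.card) ≃ t := Equiv.ulift.trans t.equivFin.symm
  have he : ∀ a, ∃ b, (e a : N) ∈ 𝒩 b := fun a => ht _ (e a).2
  choose deg hdeg using he
  refine ⟨ULift.{w} (Fin t.card), inferInstance, deg,
    Finsupp.linearCombination _ fun a => (e a : N), isGradedMap_linearCombination _ _ hdeg, ?_, ?_⟩
  · rw [Finsupp.range_linearCombination, ← hspan]
    congr 1
    ext x
    exact ⟨by rintro ⟨a, rfl⟩; exact (e a).2, fun hx => ⟨e.symm ⟨x, hx⟩, by simp⟩⟩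
  · intro x hx
    rw [mem_smul_top_iff]
    intro a
    by_contra hxa
    have hgr := isGradedMap_linearCombination (n := n) (k := k) deg (fun a => (e a : N)) hdeg
    obtain ⟨b, hb⟩ : ∃ b, (DirectSum.decompose (freeGrading (k := k) (n := n) deg) x b :
        ULift.{w} (Fin t.card) →₀ CoxRing k n) a ∉ varIdeal k n := by
      by_contra! hall
      refine hxa ?_
      rw [← DirectSum.sum_support_decompose (freeGrading (k := k) (n := n) deg) x,
        Finsupp.finsetSum_apply]
      exact sum_mem fun b _ => hall b
    have hmem := (DirectSum.decompose (freeGrading (k := k) (n := n) deg) x b).2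
    have hker := hgr.isHomogeneousSub_ker b x hx
    generalize (DirectSum.decompose (freeGrading (k := k) (n := n) deg) x b :
        ULift.{w} (Fin t.card) →₀ CoxRing k n) = y at hb hmem hker
    -- A homogeneous coefficient outside `𝔪` has degree zero and is therefore a nonzero constant
    -- `c`.
    have hbd : b - deg a = 0 := by
      by_contra h
      exact hb (mem_varIdeal_of_mem_coxGrading (hmem a) h)
    have hy := eq_C_of_mem_coxGrading_zero (hbd ▸ hmem a)
    rw [mem_varIdeal_iff] at hb
    set c := MvPolynomial.constantCoeff (y a)
    refine hmin _ (e a).2 ?_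
    have hsum : ∑ a', y a' • (e a' : N) = 0 := by
      rw [LinearMap.mem_ker, Finsupp.linearCombination_apply, Finsupp.sum_fintype _ _ (by simp)]
        at hker
      exact hker
    rw [← Finset.add_sum_erase _ _ (Finset.mem_univ a)] at hsum
    have h1 : (MvPolynomial.C c : CoxRing k n) • (e a : N) ∈
        Submodule.span (CoxRing k n) ((t.erase (e a) : Finset N) : Set N) := by
      rw [← hy, eq_neg_of_add_eq_zero_left hsum]
      refine neg_mem (sum_mem fun a' ha' => Submodule.smul_mem _ _ (Submodule.subset_span ?_))
      refine Finset.mem_coe.2 (Finset.mem_erase.2 ⟨fun h => ?_, (e a').2⟩)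
      exact (Finset.mem_erase.1 ha').1 (e.injective (Subtype.ext h))
    -- Dividing the relation by `c` expresses one generator through the others, contradicting
    -- minimality.
    have h2 := Submodule.smul_mem _ (MvPolynomial.C c⁻¹ : CoxRing k n) h1
    rwa [smul_smul, ← map_mul, inv_mul_cancel₀ hb, map_one, one_smul] at h2

variable (k n) in
/-- A finite graded free module with a homogeneous submodule contained in the multiples of the
irrelevant ideal. -/
structure MinimalStage where
  /-- The index set of the basis. -/
  ι : Type w
  finite : Finite ι
  /-- The degrees of the basis elements. -/
  deg : ι → Fin r → ℤ
  /-- The submodule. -/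
  K : Submodule (CoxRing k n) (ι →₀ CoxRing k n)
  hom : IsHomogeneousSub (freeGrading deg) K
  le : K ≤ varIdeal k n • ⊤

/-- A cover of `s.K` by the free module of `t`, with kernel `t.K`. -/
def MinimalStage.Covers (t s : MinimalStage.{v, w} k n)
    (f : (t.ι →₀ CoxRing k n) →ₗ[CoxRing k n] (s.ι →₀ CoxRing k n)) : Prop :=
  IsGradedMap (freeGrading t.deg) (freeGrading s.deg) f ∧ LinearMap.range f = s.K ∧
    LinearMap.ker f = t.K

theorem MinimalStage.exists_covers (s : MinimalStage.{v, w} k n) :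
    ∃ t f, MinimalStage.Covers t s f := by
  have := s.finite
  have : IsNoetherian (CoxRing k n) (s.ι →₀ CoxRing k n) := inferInstance
  obtain ⟨ι, hι, deg, f, hf, hr, hk⟩ :=
    exists_minimal_cover.{v, w} s.hom (IsNoetherian.noetherian s.K)
  exact ⟨⟨ι, hι, deg, LinearMap.ker f, hf.isHomogeneousSub_ker, hk⟩, f, hf, hr, rfl⟩

/-- Minimal graded free resolutions of finitely generated homogeneous submodules. -/
theorem exists_minimal_resolution [DirectSum.Decomposition 𝒩]
    [SetLike.GradedSMul (coxGrading k n) 𝒩] {K : Submodule (CoxRing k n) N}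
    (hK : IsHomogeneousSub 𝒩 K) (hfg : K.FG) :
    ∃ (s : ℕ → MinimalStage.{v, w} k n)
      (d : ∀ i, ((s (i + 1)).ι →₀ CoxRing k n) →ₗ[CoxRing k n] ((s i).ι →₀ CoxRing k n))
      (f : ((s 0).ι →₀ CoxRing k n) →ₗ[CoxRing k n] N),
      (∀ i, MinimalStage.Covers (s (i + 1)) (s i) (d i)) ∧
      IsGradedMap (freeGrading (s 0).deg) 𝒩 f ∧ LinearMap.range f = K ∧
      LinearMap.ker f = (s 0).K := by
  obtain ⟨ι, hι, deg, f, hf, hr, hk⟩ := exists_minimal_cover.{v, w} hK hfg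
  choose next d hd using MinimalStage.exists_covers.{v, w} (k := k) (n := n)
  let s : ℕ → MinimalStage.{v, w} k n := fun i =>
    Nat.rec ⟨ι, hι, deg, LinearMap.ker f, hf.isHomogeneousSub_ker, hk⟩ (fun _ t => next t) i
  exact ⟨s, fun i => d (s i), f, fun i => hd (s i), hf, hr, rfl⟩

end MinimalCovers

/-! ### Comparison of a minimal resolution with another resolution -/

section Comparison

variable {k : Type v} [Field k] {r : ℕ} {n : Fin r → ℕ}

variable (k n) in
/-- For the kernel `K` of the augmentation `F_0 → M` of a graded free resolution `F` of `M`, the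
vanishing of `Tor_{j+1}(M, k)_b`, computed from `F`. -/
def SyzygyTorVanishes (b : Fin r → ℤ) : ℕ → ∀ (ι : Type w) (_ : ι → Fin r → ℤ)
    (_ : Submodule (CoxRing k n) (ι →₀ CoxRing k n)), Prop
  -- Tensoring `0 → K → F_0 → M → 0` with the residue field identifies `Tor_1` with `(K ∩ 𝔪F_0) /
  -- 𝔪K`; this clause is its vanishing in degree `b`.
  | 0, _, deg, K => ∀ x ∈ K, x ∈ freeGrading deg b → x ∈ varIdeal k n •
      (⊤ : Submodule (CoxRing k n) (_ →₀ CoxRing k n)) → x ∈ varIdeal k n • K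
  | j + 1, ι, deg, K => ∃ (κ : Type w) (deg' : κ → Fin r → ℤ)
      (f : (κ →₀ CoxRing k n) →ₗ[CoxRing k n] (ι →₀ CoxRing k n)),
      IsGradedMap (freeGrading deg') (freeGrading deg) f ∧ LinearMap.range f = K ∧
        SyzygyTorVanishes b j κ deg' (LinearMap.ker f)

variable {b : Fin r → ℤ}

theorem mem_smul_range_of_avoiding {N : Type*} [AddCommGroup N] [Module (CoxRing k n) N]
    {𝒩 : (Fin r → ℤ) → AddSubgroup N} [DirectSum.Decomposition 𝒩] {κ : Type*}
    {deg : κ → Fin r → ℤ} {f : (κ →₀ CoxRing k n) →ₗ[CoxRing k n] N}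
    (hf : IsGradedMap (freeGrading deg) 𝒩 f) (hb : ∀ a, deg a ≠ b) {x : N} (hx : x ∈ 𝒩 b)
    (hxf : x ∈ LinearMap.range f) : x ∈ varIdeal k n • LinearMap.range f := by
  rw [LinearMap.range_eq_map] at hxf ⊢
  obtain ⟨y, -, hy, rfl⟩ := hf.exists_homogeneous .top hx hxf
  rw [← Submodule.map_smul'']
  exact ⟨y, mem_varIdeal_smul_top_of_ne hb hy, rfl⟩

/-- `Tor_{j+1}` is a subquotient of the `(j+1)`-st term tensored with the residue field, which is
zero in degree `b`. -/
theorem ResolvesAvoiding.syzygyTorVanishes {j : ℕ} {ι : Type w} {deg : ι → Fin r → ℤ}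
    {K : Submodule (CoxRing k n) (ι →₀ CoxRing k n)}
    (h : ResolvesAvoiding.{v, w} k n b (j + 1) ι deg K) :
    SyzygyTorVanishes.{v, w} k n b j ι deg K := by
  induction j generalizing ι with
  | zero =>
    obtain ⟨κ, deg', f, hf, rfl, hb⟩ := h
    exact fun x hx hxb _ => mem_smul_range_of_avoiding hf hb hxb hx
  | succ j ih =>
    obtain ⟨κ, deg', f, hf, hr, h⟩ := h
    exact ⟨κ, deg', f, hf, hr, ih h⟩

/-- In a minimal cover of `K`, no generator lies in degree `b` if all elements of `K` of degree `b`
are multiples of the variables. -/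
theorem deg_ne_of_minimal_cover {N : Type*} [AddCommGroup N] [Module (CoxRing k n) N]
    {𝒩 : (Fin r → ℤ) → AddSubgroup N} {ι : Type*} {deg : ι → Fin r → ℤ}
    {f : (ι →₀ CoxRing k n) →ₗ[CoxRing k n] N} (hf : IsGradedMap (freeGrading deg) 𝒩 f)
    (hk : LinearMap.ker f ≤ varIdeal k n • ⊤)
    (h : ∀ x ∈ LinearMap.range f, x ∈ 𝒩 b → x ∈ varIdeal k n • LinearMap.range f) (a : ι) :
    deg a ≠ b := by
  rintro rfl
  have h1 := h _ ⟨Finsupp.single a 1, rfl⟩ (hf _ _ (single_one_mem_freeGrading deg a))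
  rw [LinearMap.range_eq_map, ← Submodule.map_smul''] at h1
  -- The basis element `a` differs from `y ∈ 𝔪F` by an element of the kernel, which also lies in
  -- `𝔪F`; but a basis element never does.
  obtain ⟨y, hy, hya⟩ := h1
  refine single_one_notMem_varIdeal_smul_top (k := k) (n := n) a ?_
  rw [← sub_add_cancel (Finsupp.single a 1) y]
  exact Submodule.add_mem _ (hk (by simp [hya])) hy

theorem map_mem_smul {N P : Type*} [AddCommGroup N] [Module (CoxRing k n) N]
    [AddCommGroup P] [Module (CoxRing k n) P] {I : Ideal (CoxRing k n)}
    {K : Submodule (CoxRing k n) N} {L : Submodule (CoxRing k n) P}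
    {f : N →ₗ[CoxRing k n] P} (hf : ∀ x ∈ K, f x ∈ L) {x : N} (hx : x ∈ I • K) :
    f x ∈ I • L := by
  have h : f x ∈ (I • K).map f := ⟨x, hx, rfl⟩
  rw [Submodule.map_smul''] at h
  exact Submodule.smul_mono le_rfl (Submodule.map_le_iff_le_comap.2 hf) h

/-- A minimal resolution has no generator of degree `b` where `Tor`, computed from another
resolution, vanishes. -/
theorem deg_ne_of_syzygyTorVanishes {s : ℕ → MinimalStage.{v, w} k n}
    {d : ∀ i, ((s (i + 1)).ι →₀ CoxRing k n) →ₗ[CoxRing k n] ((s i).ι →₀ CoxRing k n)}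
    (hd : ∀ i, MinimalStage.Covers (s (i + 1)) (s i) (d i)) (i j : ℕ) {m : ℕ}
    (hm : m = i + j + 1) {κ : Type w} {deg : κ → Fin r → ℤ}
    {L : Submodule (CoxRing k n) (κ →₀ CoxRing k n)}
    (hL : SyzygyTorVanishes.{v, w} k n b j κ deg L)
    {φ : ((s i).ι →₀ CoxRing k n) →ₗ[CoxRing k n] (κ →₀ CoxRing k n)}
    {ψ : (κ →₀ CoxRing k n) →ₗ[CoxRing k n] ((s i).ι →₀ CoxRing k n)}
    {h : ((s i).ι →₀ CoxRing k n) →ₗ[CoxRing k n] ((s i).ι →₀ CoxRing k n)}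
    (hφ : IsGradedMap (freeGrading (s i).deg) (freeGrading deg) φ)
    (hψ : IsGradedMap (freeGrading deg) (freeGrading (s i).deg) ψ)
    (hh : IsGradedMap (freeGrading (s i).deg) (freeGrading (s i).deg) h)
    (hφL : ∀ x ∈ (s i).K, φ x ∈ L) (hψK : ∀ y ∈ L, ψ y ∈ (s i).K) (hhK : ∀ x, h x ∈ (s i).K)
    (hψφ : ∀ x ∈ (s i).K, ψ (φ x) = x + h x) (a : (s m).ι) : (s m).deg a ≠ b := by
  subst hm
  -- In place of a chain homotopy, each stage carries comparison maps `φ`, `ψ` and an error `h` with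
  -- values in the syzygies, such that `ψφ = 1 + h` on the syzygies.
  induction j generalizing i κ with
  | zero =>
    obtain ⟨hg, hr, hk⟩ := hd i
    refine deg_ne_of_minimal_cover hg (hk.trans_le (s (i + 1)).le) (fun x hx hxb => ?_) a
    rw [hr] at hx ⊢
    have hxm := (s i).le hx
    -- Since `x ∈ 𝔪F`, the vanishing of `Tor` puts `φ x` in `𝔪L`. Then `ψ (φ x)` and `h x` both lie
    -- in `𝔪K`, hence so does their difference `x`.
    have h1 : φ x ∈ varIdeal k n • L := hL _ (hφL x hx) (hφ _ _ hxb)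
      (map_mem_smul (fun _ _ => Submodule.mem_top) hxm)
    have h2 := map_mem_smul hψK h1
    have h3 := map_mem_smul (f := h) (fun x _ => hhK x) hxm
    rw [hψφ x hx] at h2
    exact (Submodule.add_mem_iff_left _ h3).1 h2
  | succ j ih =>
    obtain ⟨κ', deg', p, hp, hr, hL⟩ := hL
    obtain ⟨hg, hrd, hk⟩ := hd i
    obtain ⟨φ', hφ', -, hφp⟩ := exists_graded_lift (hφ.comp hg) hp .top (by
      rw [← LinearMap.range_eq_map, hr]
      rintro _ ⟨x, rfl⟩
      exact hφL _ (hrd ▸ ⟨x, rfl⟩))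
    obtain ⟨ψ', hψ', -, hψp⟩ := exists_graded_lift (hψ.comp hp) hg .top (by
      rw [← LinearMap.range_eq_map, hrd]
      rintro _ ⟨x, rfl⟩
      exact hψK _ (hr ▸ ⟨x, rfl⟩))
    obtain ⟨h', hh', -, hhp⟩ := exists_graded_lift hh hg .top (by
      rw [← LinearMap.range_eq_map, hrd]
      rintro _ ⟨x, rfl⟩
      exact hhK _)
    have e1 : ∀ x, p (φ' x) = φ (d i x) := LinearMap.congr_fun hφp
    have e2 : ∀ x, d i (ψ' x) = ψ (p x) := LinearMap.congr_fun hψp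
    have e3 : ∀ x, d i (h' x) = h x := LinearMap.congr_fun hhp
    have e : i + (j + 1) + 1 = (i + 1) + j + 1 := by ring
    revert a
    rw [e]
    intro a
    -- The new error subtracts `h' ∘ d`, where `h'` lifts `h`: this makes the differential kill it,
    -- and does not alter it on the next syzygies, where `d` vanishes.
    refine ih (i + 1) hL (φ := φ') (ψ := ψ') (h := ψ' ∘ₗ φ' - LinearMap.id - h' ∘ₗ d i)
      hφ' hψ' (((hψ'.comp hφ').sub .id).sub (hh'.comp hg)) ?_ ?_ ?_ ?_ a
    · intro x hx
      rw [← hk, LinearMap.mem_ker] at hx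
      rw [LinearMap.mem_ker, e1, hx, map_zero]
    · intro y hy
      rw [LinearMap.mem_ker] at hy
      rw [← hk, LinearMap.mem_ker, e2, hy, map_zero]
    · intro x
      rw [← hk, LinearMap.mem_ker]
      have hx : d i x ∈ (s i).K := hrd ▸ ⟨x, rfl⟩
      simp [e1, e2, e3, hψφ _ hx]
    · intro x hx
      rw [← hk, LinearMap.mem_ker] at hx
      simp [hx]

/-- A minimal resolution of `K` has no generator of degree `b` where `Tor`, computed from another
resolution of `K`, vanishes. -/
theorem deg_succ_ne_of_syzygyTorVanishes {N : Type*} [AddCommGroup N] [Module (CoxRing k n) N]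
    {𝒩 : (Fin r → ℤ) → AddSubgroup N} [DirectSum.Decomposition 𝒩]
    {s : ℕ → MinimalStage.{v, w} k n}
    {d : ∀ i, ((s (i + 1)).ι →₀ CoxRing k n) →ₗ[CoxRing k n] ((s i).ι →₀ CoxRing k n)}
    (hd : ∀ i, MinimalStage.Covers (s (i + 1)) (s i) (d i))
    {f : ((s 0).ι →₀ CoxRing k n) →ₗ[CoxRing k n] N}
    (hf : IsGradedMap (freeGrading (s 0).deg) 𝒩 f) (hk : LinearMap.ker f = (s 0).K)
    {κ : Type w} {deg : κ → Fin r → ℤ} {g : (κ →₀ CoxRing k n) →ₗ[CoxRing k n] N}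
    (hg : IsGradedMap (freeGrading deg) 𝒩 g) (hfg : LinearMap.range f = LinearMap.range g)
    {j : ℕ} (h : SyzygyTorVanishes.{v, w} k n b j κ deg (LinearMap.ker g))
    (a : (s (j + 1)).ι) : (s (j + 1)).deg a ≠ b := by
  obtain ⟨φ, hφ, -, hφg⟩ := exists_graded_lift hf hg .top
    (by rw [← LinearMap.range_eq_map, hfg])
  obtain ⟨ψ, hψ, -, hψf⟩ := exists_graded_lift hg hf .top
    (by rw [← LinearMap.range_eq_map, hfg])
  have e1 : ∀ x, g (φ x) = f x := LinearMap.congr_fun hφg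
  have e2 : ∀ x, f (ψ x) = g x := LinearMap.congr_fun hψf
  -- The initial error `ψφ - 1` takes values in `ker f`, because `ψφ` commutes with the
  -- augmentation.
  refine deg_ne_of_syzygyTorVanishes hd 0 j (by ring) h (h := ψ ∘ₗ φ - LinearMap.id) hφ hψ
    ((hψ.comp hφ).sub .id) ?_ ?_ ?_ ?_ a
  · intro x hx
    rw [← hk, LinearMap.mem_ker] at hx
    rw [LinearMap.mem_ker, e1, hx]
  · intro y hy
    rw [LinearMap.mem_ker] at hy
    rw [← hk, LinearMap.mem_ker, e2, hy]
  · intro x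
    rw [← hk, LinearMap.mem_ker]
    simp [e1, e2]
  · intro x _
    simp

end Comparison

/-! ### The graded Betti degrees bound the degrees of a minimal resolution -/

section Tor

variable {k : Type v} [Field k] {r : ℕ} {n : Fin r → ℕ}

theorem tmul_one_eq_zero_iff {N : Type*} [AddCommGroup N] [Module (CoxRing k n) N] (x : N) :
    x ⊗ₜ[CoxRing k n] (1 : ResidueField k n) = 0 ↔
      x ∈ varIdeal k n • (⊤ : Submodule (CoxRing k n) N) := by
  rw [← (TensorProduct.tensorQuotEquivQuotSMul N (varIdeal k n)).map_eq_zero_iff,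
    ← map_one (Ideal.Quotient.mk _), TensorProduct.tensorQuotEquivQuotSMul_tmul_mk, one_smul,
    Submodule.Quotient.mk_eq_zero]

variable {M : Type u} [AddCommGroup M] [Module (CoxRing k n) M]
  {ℳ : (Fin r → ℤ) → AddSubgroup M} (F : GradedFreeResolution (k := k) (n := n) ℳ)
  {b : Fin r → ℤ}

theorem GradedFreeResolution.mem_boundaries {i : ℕ} [Subsingleton (F.TensorHomology i b)]
    {x : F.Tensor i} (hx : x ∈ F.cycles i b) : x ∈ F.boundaries i b := by
  have h : ((⟨x, hx⟩ : F.cycles i b) : F.TensorHomology i b) = 0 := Subsingleton.elim _ _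
  rw [QuotientAddGroup.eq_zero_iff] at h
  exact h

theorem GradedFreeResolution.exists_sub_mem {i : ℕ} [Subsingleton (F.TensorHomology i b)]
    {x : F.ι i →₀ CoxRing k n} (hx : x ⊗ₜ 1 ∈ F.cycles i b) :
    ∃ y, x - F.d i y ∈ varIdeal k n • (⊤ : Submodule (CoxRing k n) (F.ι i →₀ CoxRing k n)) := by
  obtain ⟨_, ⟨y, -, rfl⟩, hy⟩ := F.mem_boundaries hx
  refine ⟨y, (tmul_one_eq_zero_iff (k := k) (n := n) _).1 ?_⟩
  rw [TensorProduct.sub_tmul, sub_eq_zero]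
  exact hy.symm

/-- Dimension shifting: from `F_i` on, `F` resolves the cokernel of `d i`, whose `Tor_{j+1}` is the
homology of `F ⊗ k` at `i + j + 1`. -/
theorem GradedFreeResolution.syzygyTorVanishes (i j : ℕ)
    (h : Subsingleton (F.TensorHomology (i + j + 1) b)) :
    SyzygyTorVanishes.{v, max u v} k n b j (F.ι i) (F.deg i) (LinearMap.range (F.d i)) := by
  induction j generalizing i with
  | zero =>
    intro x hx hxb hxm
    rw [LinearMap.range_eq_map] at hx
    obtain ⟨y, -, hy, rfl⟩ :=
      IsGradedMap.exists_homogeneous (F.d_mem i) (.top) hxb hx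
    -- As `d y ∈ 𝔪F_i`, the class of `y` is a cycle, hence a boundary modulo `𝔪`. Replacing `y` by
    -- `y - d z ∈ 𝔪F_{i+1}` does not change its image.
    obtain ⟨z, hz⟩ := F.exists_sub_mem (i := i + 1) (b := b) (x := y)
      ⟨⟨y, hy, rfl⟩, (tmul_one_eq_zero_iff _).2 hxm⟩
    have h1 : F.d i (y - F.d (i + 1) z) ∈ varIdeal k n • LinearMap.range (F.d i) :=
      map_mem_smul (fun x _ => LinearMap.mem_range_self _ x) hz
    rwa [map_sub, (F.exact i).apply_apply_eq_zero, sub_zero] at h1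
  | succ j ih =>
    refine ⟨_, _, F.d i, F.d_mem i, rfl, ?_⟩
    rw [LinearMap.exact_iff.1 (F.exact i)]
    exact ih (i + 1) (by rwa [show i + 1 + j + 1 = i + (j + 1) + 1 by ring])

variable [DirectSum.Decomposition ℳ] [SetLike.GradedSMul (coxGrading k n) ℳ]

/-- Independence of `Tor` from the resolution enters only in this form: where the homology of the
chosen resolution vanishes, a minimal one has no generator. -/
theorem deg_mem_bettiDegrees {s : ℕ → MinimalStage.{v, max u v} k n}
    {d : ∀ i, ((s (i + 1)).ι →₀ CoxRing k n) →ₗ[CoxRing k n] ((s i).ι →₀ CoxRing k n)}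
    (hd : ∀ i, MinimalStage.Covers (s (i + 1)) (s i) (d i))
    {f : ((s 0).ι →₀ CoxRing k n) →ₗ[CoxRing k n] M}
    (hf : IsGradedMap (freeGrading (s 0).deg) ℳ f) (hk : LinearMap.ker f = (s 0).K)
    (hr : LinearMap.range f = ⊤) (i : ℕ) (a : (s i).ι) :
    (s i).deg a ∈ bettiDegrees (k := k) (n := n) ℳ i := by
  by_contra hcon
  have hsub := not_nontrivial_iff_subsingleton.1 hcon
  let F := Classical.choice (nonempty_gradedFreeResolution (k := k) (n := n) ℳ)
  have hF : LinearMap.range F.aug = ⊤ := LinearMap.range_eq_top.2 F.aug_surjective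
  cases i with
  | zero =>
    refine deg_ne_of_minimal_cover hf (hk.trans_le (s 0).le) (fun x _ hxb => ?_) a rfl
    have hxF : x ∈ (⊤ : Submodule (CoxRing k n) _).map F.aug := by
      rw [← LinearMap.range_eq_map, hF]; trivial
    obtain ⟨y, -, hy, rfl⟩ := IsGradedMap.exists_homogeneous F.aug_mem .top hxb hxF
    obtain ⟨z, hz⟩ := F.exists_sub_mem (i := 0) (x := y) ⟨y, hy, rfl⟩
    have h1 : F.aug (y - F.d 0 z) ∈ varIdeal k n • LinearMap.range f :=
      map_mem_smul (fun x _ => hr ▸ Submodule.mem_top) hz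
    rwa [map_sub, F.exact_aug.apply_apply_eq_zero, sub_zero] at h1
  | succ i =>
    refine deg_succ_ne_of_syzygyTorVanishes hd hf hk F.aug_mem (hr.trans hF.symm) ?_ a rfl
    rw [LinearMap.exact_iff.1 F.exact_aug]
    exact F.syzygyTorVanishes 0 i (by rwa [zero_add])

end Tor

/-! ### Monomial submodules of graded free modules -/

section Monomial

variable (k : Type v) [Field k] {r : ℕ} {n : Fin r → ℕ}

/-- The ideal spanned by the monomials with exponents in an upper set. -/
def monomialIdeal (U : UpperSet ((Σ i : Fin r, Fin (n i + 1)) →₀ ℕ)) : Ideal (CoxRing k n) where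
  carrier := {f | ∀ u ∈ f.support, u ∈ U}
  zero_mem' := by simp
  add_mem' := by
    classical
    intro f g hf hg u hu
    rcases Finset.mem_union.1 (MvPolynomial.support_add hu) with h | h
    exacts [hf u h, hg u h]
  smul_mem' := by
    classical
    intro s f hf u hu
    obtain ⟨t, -, u', hu', rfl⟩ := Finset.mem_add.1 (MvPolynomial.support_mul s f hu)
    exact U.upper le_add_self (hf u' hu')

/-- The submodule of a free module whose components lie in given monomial ideals. -/
def monomialSub {ι : Type*} (U : ι → UpperSet ((Σ i : Fin r, Fin (n i + 1)) →₀ ℕ)) :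
    Submodule (CoxRing k n) (ι →₀ CoxRing k n) where
  carrier := {f | ∀ a, f a ∈ monomialIdeal k (U a)}
  zero_mem' := fun _ => Submodule.zero_mem _
  add_mem' := fun hf hg a => Submodule.add_mem _ (hf a) (hg a)
  smul_mem' := fun s _ hf a => Submodule.smul_mem _ s (hf a)

variable {k}

/-- A monomial `u` in the summand `a` occurs only in the component of degree `weight u + deg a`, so
components cannot cancel each other. -/
theorem support_decompose_subset {ι : Type*} (deg : ι → Fin r → ℤ) (x : ι →₀ CoxRing k n)
    (b : Fin r → ℤ) (a : ι) :
    ((DirectSum.decompose (freeGrading (k := k) (n := n) deg) x b : ι →₀ CoxRing k n) a).support ⊆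
      (x a).support := by
  classical
  intro u hu
  have hdeg : ∀ c, MvPolynomial.coeff u ((DirectSum.decompose (freeGrading (k := k) (n := n) deg) x
      c : ι →₀ CoxRing k n) a) ≠ 0 → Finsupp.weight (varDegree n) u = c - deg a := fun c hc =>
    (DirectSum.decompose (freeGrading (k := k) (n := n) deg) x c).2 a hc
  rw [MvPolynomial.mem_support_iff] at hu ⊢
  have hsum := congrArg (fun y : ι →₀ CoxRing k n => MvPolynomial.coeff u (y a))
    (DirectSum.sum_support_decompose (freeGrading (k := k) (n := n) deg) x)
  simp only [Finsupp.finsetSum_apply, MvPolynomial.coeff_sum] at hsum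
  rw [← hsum, Finset.sum_eq_single b]
  · exact hu
  · intro c _ hcb
    by_contra hc
    exact hcb (sub_left_injective ((hdeg c hc).symm.trans (hdeg b hu)))
  · intro hb
    rw [DFinsupp.notMem_support_iff.1 hb]
    simp

theorem isHomogeneousSub_monomialSub {ι : Type*} (deg : ι → Fin r → ℤ)
    (U : ι → UpperSet ((Σ i : Fin r, Fin (n i + 1)) →₀ ℕ)) :
    IsHomogeneousSub (freeGrading deg) (monomialSub k U) :=
  fun b x hx a u hu => hx a u (support_decompose_subset deg x b a hu)

variable {b : Fin r → ℤ}

/-- The projection of a graded free module to one of its summands. -/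
noncomputable def freeProj {ι : Type*} (a : ι) :
    (ι →₀ CoxRing k n) →ₗ[CoxRing k n] (PUnit.{w + 1} →₀ CoxRing k n) :=
  Finsupp.lsingle PUnit.unit ∘ₗ Finsupp.lapply a

theorem freeProj_apply {ι : Type*} (a : ι) (x : ι →₀ CoxRing k n) (t : PUnit.{w + 1}) :
    freeProj a x t = x a := by
  simp [freeProj]

theorem isGradedMap_freeProj {ι : Type*} (deg : ι → Fin r → ℤ) (a : ι) :
    IsGradedMap (freeGrading (k := k) (n := n) deg) (freeGrading fun _ : PUnit.{w + 1} => deg a)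
      (freeProj a) := by
  intro b x hx t
  rw [freeProj_apply]
  exact hx a

theorem hasAvoidingRes_monomialSub {ι : Type*} [Finite ι] (deg : ι → Fin r → ℤ)
    (U : ι → UpperSet ((Σ i : Fin r, Fin (n i + 1)) →₀ ℕ)) {j : ℕ}
    (h : ∀ a, HasAvoidingRes.{v, w} b j (freeGrading fun _ : PUnit.{w + 1} => deg a)
      (monomialSub k fun _ => U a)) :
    HasAvoidingRes.{v, w} b j (freeGrading deg) (monomialSub k U) := by
  classical
  have := Fintype.ofFinite ι
  -- In `UpperSet` the order is reversed and `⊤` is empty, so the components outside `s` are zero.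
  -- Adding an index is an extension along the projection to that summand.
  have key : ∀ s : Finset ι, HasAvoidingRes.{v, w} b j (freeGrading deg)
      (monomialSub k fun a => if a ∈ s then U a else ⊤) := by
    intro s
    induction s using Finset.induction_on with
    | empty =>
      have : monomialSub k (fun a : ι => if a ∈ (∅ : Finset ι) then U a else ⊤) = ⊥ := by
        refine (Submodule.eq_bot_iff _).2 fun f hf => ?_
        ext1 a
        refine MvPolynomial.support_eq_empty.1 (Finset.eq_empty_of_forall_notMem fun u hu => ?_)
        simpa using hf a u hu
      rw [this]
      exact hasAvoidingRes_bot j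
    | insert a s ha ih =>
      refine .extension (isGradedMap_freeProj deg a) (isHomogeneousSub_monomialSub _ _) ?_ ?_
      · convert ih using 1
        ext f
        constructor
        · rintro ⟨hf, hfa⟩ a'
          have h0 : f a = 0 := by
            rw [← freeProj_apply a f PUnit.unit, show freeProj a f = 0 from hfa]; rfl
          by_cases haa : a' = a
          · subst haa
            rw [h0]
            exact Submodule.zero_mem _
          · have := hf a'
            simpa [haa] using this
        · intro hf
          have h0 : f a = 0 := by
            refine MvPolynomial.support_eq_empty.1
              (Finset.eq_empty_of_forall_notMem fun u hu => ?_)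
            simpa [ha] using hf a u hu
          refine ⟨fun a' => ?_, ?_⟩
          · by_cases haa : a' = a
            · subst haa
              rw [h0]
              exact Submodule.zero_mem _
            · have := hf a'
              simpa [haa] using this
          · refine LinearMap.mem_ker.2 (Finsupp.ext fun t => ?_)
            rw [freeProj_apply, h0]; rfl
      · convert h a using 1
        ext f
        constructor
        · rintro ⟨y, hy, rfl⟩ t
          rw [freeProj_apply]
          simpa using hy a
        · intro hf
          refine ⟨Finsupp.single a (f PUnit.unit), fun a' => ?_, ?_⟩
          · by_cases haa : a' = a
            · subst haa
              simpa using hf PUnit.unit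
            · rw [Finsupp.single_eq_of_ne haa]
              exact Submodule.zero_mem _
          · refine Finsupp.ext fun t => ?_
            rw [freeProj_apply, Finsupp.single_eq_same]
  simpa using key Finset.univ

/-! ### Ideals given by a lower bound on the multidegree in a set of variables -/

/-- The exponents whose part in the variables of `W` has multidegree at least `c`. -/
def degreeUpperSet (W : Finset (Σ i : Fin r, Fin (n i + 1))) (c : Fin r → ℕ) :
    UpperSet ((Σ i : Fin r, Fin (n i + 1)) →₀ ℕ) where
  carrier := {u | ∀ i, c i ≤ ∑ x ∈ W, if x.1 = i then u x else 0}
  upper' := by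
    intro u u' huu hu i
    refine (hu i).trans (Finset.sum_le_sum fun x _ => ?_)
    split_ifs
    exacts [huu x, le_rfl]

theorem mem_degreeUpperSet {W : Finset (Σ i : Fin r, Fin (n i + 1))} {c : Fin r → ℕ}
    {u : (Σ i : Fin r, Fin (n i + 1)) →₀ ℕ} :
    u ∈ degreeUpperSet W c ↔ ∀ i, c i ≤ ∑ x ∈ W, if x.1 = i then u x else 0 :=
  Iff.rfl

/-- A free module resolves itself with zero higher terms, so its degrees matter only for `j = 0`. -/
theorem hasAvoidingRes_top {ι : Type w} {deg : ι → Fin r → ℤ} {j : ℕ}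
    (h : j = 0 → ∀ a, deg a ≠ b) :
    HasAvoidingRes.{v, w} b j (freeGrading deg)
      (⊤ : Submodule (CoxRing k n) (ι →₀ CoxRing k n)) := by
  refine ⟨ι, deg, LinearMap.id, .id, LinearMap.range_id, ?_⟩
  rw [LinearMap.ker_id]
  cases j with
  | zero => exact h rfl
  | succ j => exact hasAvoidingRes_bot j

theorem X_mul_mem_monomialIdeal {U V : UpperSet ((Σ i : Fin r, Fin (n i + 1)) →₀ ℕ)}
    (x : Σ i : Fin r, Fin (n i + 1)) (h : ∀ u ∈ U, Finsupp.single x 1 + u ∈ V)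
    {p : CoxRing k n} (hp : p ∈ monomialIdeal k U) :
    MvPolynomial.X x * p ∈ monomialIdeal k V := by
  intro u hu
  rw [MvPolynomial.support_X_mul, Finset.mem_map] at hu
  obtain ⟨u', hu', rfl⟩ := hu
  exact h u' (hp u' hu')

theorem mem_monomialIdeal_of_X_mul {U V : UpperSet ((Σ i : Fin r, Fin (n i + 1)) →₀ ℕ)}
    (x : Σ i : Fin r, Fin (n i + 1)) (h : ∀ u, Finsupp.single x 1 + u ∈ V → u ∈ U)
    {p : CoxRing k n} (hp : MvPolynomial.X x * p ∈ monomialIdeal k V) :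
    p ∈ monomialIdeal k U := by
  intro u hu
  refine h u (hp _ ?_)
  rw [MvPolynomial.support_X_mul, Finset.mem_map]
  exact ⟨u, hu, rfl⟩

theorem monomialIdeal_mono {U V : UpperSet ((Σ i : Fin r, Fin (n i + 1)) →₀ ℕ)}
    (h : ∀ u ∈ U, u ∈ V) : monomialIdeal k U ≤ monomialIdeal k V :=
  fun _ hp u hu => h u (hp u hu)

/-! ### The exact sequence splitting off one variable -/

section Step

variable (x : Σ i : Fin r, Fin (n i + 1))

variable (k) in
/-- The map `(p, q) ↦ x p + q`. -/
noncomputable def stepSum :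
    (PUnit.{w + 1} ⊕ PUnit.{w + 1} →₀ CoxRing k n) →ₗ[CoxRing k n]
      (PUnit.{w + 1} →₀ CoxRing k n) :=
  Finsupp.linearCombination _
    (Sum.elim (fun t => Finsupp.single t (MvPolynomial.X x)) fun t => Finsupp.single t 1)

variable (k) in
/-- The map `p ↦ (p, -x p)`. -/
noncomputable def stepKer :
    (PUnit.{w + 1} →₀ CoxRing k n) →ₗ[CoxRing k n]
      (PUnit.{w + 1} ⊕ PUnit.{w + 1} →₀ CoxRing k n) :=
  Finsupp.linearCombination _
    fun t => Finsupp.single (Sum.inl t) 1 - Finsupp.single (Sum.inr t) (MvPolynomial.X x)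

theorem stepSum_apply (z : PUnit.{w + 1} ⊕ PUnit.{w + 1} →₀ CoxRing k n) (t : PUnit.{w + 1}) :
    stepSum k x z t = MvPolynomial.X x * z (Sum.inl t) + z (Sum.inr t) := by
  rw [stepSum, Finsupp.linearCombination_apply, Finsupp.sum_fintype _ _ (by simp)]
  simp [mul_comm]

theorem stepKer_inl (p : PUnit.{w + 1} →₀ CoxRing k n) (t : PUnit.{w + 1}) :
    stepKer k x p (Sum.inl t) = p t := by
  rw [stepKer, Finsupp.linearCombination_apply, Finsupp.sum_fintype _ _ (by simp)]
  simp

theorem stepKer_inr (p : PUnit.{w + 1} →₀ CoxRing k n) (t : PUnit.{w + 1}) :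
    stepKer k x p (Sum.inr t) = -(MvPolynomial.X x * p t) := by
  rw [stepKer, Finsupp.linearCombination_apply, Finsupp.sum_fintype _ _ (by simp)]
  simp [mul_comm]

theorem X_mem_coxGrading : (MvPolynomial.X x : CoxRing k n) ∈ coxGrading k n (varDegree n x) :=
  MvPolynomial.isWeightedHomogeneous_X k (varDegree n) x

theorem isGradedMap_stepSum (e : Fin r → ℤ) :
    IsGradedMap (freeGrading (k := k) (n := n) (Sum.elim (fun _ : PUnit.{w + 1} =>
      varDegree n x + e) fun _ : PUnit.{w + 1} => e)) (freeGrading fun _ => e) (stepSum k x) := by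
  refine isGradedMap_linearCombination _ _ ?_
  rintro (t | t)
  · exact single_mem_freeGrading _ t (X_mem_coxGrading x)
  · exact single_one_mem_freeGrading _ t

theorem isGradedMap_stepKer (e : Fin r → ℤ) :
    IsGradedMap (freeGrading (k := k) (n := n) fun _ => varDegree n x + e)
      (freeGrading (Sum.elim (fun _ : PUnit.{w + 1} =>
        varDegree n x + e) fun _ : PUnit.{w + 1} => e)) (stepKer k x) := by
  refine isGradedMap_linearCombination _ _ fun t => AddSubgroup.sub_mem _ ?_ ?_
  · exact single_one_mem_freeGrading (Sum.elim (fun _ : PUnit.{w + 1} =>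
        varDegree n x + e) fun _ : PUnit.{w + 1} => e) (Sum.inl t)
  · exact single_mem_freeGrading (Sum.elim (fun _ : PUnit.{w + 1} =>
        varDegree n x + e) fun _ : PUnit.{w + 1} => e) (Sum.inr t) (X_mem_coxGrading x)

variable {x} {W : Finset (Σ i : Fin r, Fin (n i + 1))} {c c' : Fin r → ℕ}

theorem sum_insert_degree (hx : x ∉ W) (u : (Σ i : Fin r, Fin (n i + 1)) →₀ ℕ) (i : Fin r) :
    (∑ y ∈ insert x W, if y.1 = i then u y else 0) =
      (if x.1 = i then u x else 0) + ∑ y ∈ W, if y.1 = i then u y else 0 :=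
  Finset.sum_insert hx

theorem sum_single_add_degree (hx : x ∉ W) (u : (Σ i : Fin r, Fin (n i + 1)) →₀ ℕ) (i : Fin r) :
    (∑ y ∈ W, if y.1 = i then (Finsupp.single x 1 + u : _ →₀ ℕ) y else 0) =
      ∑ y ∈ W, if y.1 = i then u y else 0 := by
  refine Finset.sum_congr rfl fun y hy => ?_
  have : y ≠ x := fun h => hx (h ▸ hy)
  simp [Finsupp.single_eq_of_ne this]

/-- A monomial of the target ideal divisible by `x` has its quotient in the ideal for `c'`. One not
divisible by `x` gets no contribution from `x`, so it already meets the bound on `W`. The preimage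
is thus division with remainder by `x`. -/
theorem map_stepSum (hx : x ∉ W) (hc : c = c' + Pi.single x.1 1) :
    (monomialSub k (Sum.elim (fun _ : PUnit.{w + 1} => degreeUpperSet (insert x W) c')
      fun _ : PUnit.{w + 1} => degreeUpperSet W c)).map (stepSum k x) =
      monomialSub k fun _ => degreeUpperSet (insert x W) c := by
  ext f
  constructor
  · rintro ⟨z, hz, rfl⟩ t
    rw [stepSum_apply]
    refine Ideal.add_mem _ (X_mul_mem_monomialIdeal x ?_ (hz (Sum.inl t)))
      (monomialIdeal_mono ?_ (hz (Sum.inr t)))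
    · intro u hu i
      have := hu i
      rw [sum_insert_degree hx] at this ⊢
      rw [sum_single_add_degree hx, hc]
      by_cases h : x.1 = i
      · subst h
        simp at this ⊢
        omega
      · simp [h, Ne.symm h] at this ⊢
        exact this
    · intro u hu i
      rw [sum_insert_degree hx]
      exact (hu i).trans le_add_self
  · intro hf
    obtain ⟨z, hz1, hz2⟩ := exists_freeFst_freeSnd (κ₁ := PUnit.{w + 1}) (κ₂ := PUnit.{w + 1})
      (Finsupp.single PUnit.unit (MvPolynomial.divMonomial (f PUnit.unit) (Finsupp.single x 1)))
      (Finsupp.single PUnit.unit (MvPolynomial.modMonomial (f PUnit.unit) (Finsupp.single x 1)))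
    have e1 : z (Sum.inl PUnit.unit) =
        MvPolynomial.divMonomial (f PUnit.unit) (Finsupp.single x 1) := by
      exact (DFunLike.congr_fun hz1 PUnit.unit).trans (Finsupp.single_eq_same)
    have e2 : z (Sum.inr PUnit.unit) =
        MvPolynomial.modMonomial (f PUnit.unit) (Finsupp.single x 1) := by
      exact (DFunLike.congr_fun hz2 PUnit.unit).trans (Finsupp.single_eq_same)
    refine ⟨z, ?_, ?_⟩
    · rintro (t | t) u hu
      · rw [show t = PUnit.unit from rfl, e1, MvPolynomial.mem_support_iff,
          MvPolynomial.coeff_divMonomial] at hu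
        intro i
        have := hf PUnit.unit _ (MvPolynomial.mem_support_iff.2 hu) i
        rw [sum_insert_degree hx] at this ⊢
        rw [sum_single_add_degree hx, hc] at this
        by_cases h : x.1 = i
        · subst h
          simp at this ⊢
          omega
        · simp [h, Ne.symm h] at this ⊢
          exact this
      · rw [show t = PUnit.unit from rfl, e2, MvPolynomial.mem_support_iff] at hu
        have hle : ¬ Finsupp.single x 1 ≤ u := fun hle =>
          hu (MvPolynomial.coeff_modMonomial_of_le _ hle)
        rw [MvPolynomial.coeff_modMonomial_of_not_le _ hle] at hu
        intro i
        have := hf PUnit.unit _ (MvPolynomial.mem_support_iff.2 hu) i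
        rw [sum_insert_degree hx] at this
        have hux : u x = 0 := by
          by_contra h0
          exact hle (Finsupp.single_le_iff.2 (Nat.one_le_iff_ne_zero.2 h0))
        simpa [hux] using this
    · refine Finsupp.ext fun t => ?_
      rw [stepSum_apply, show t = PUnit.unit from rfl, e1, e2]
      exact MvPolynomial.divMonomial_add_modMonomial_single _ _

/-- The kernel consists of the pairs `(p, -x p)`. Since `x ∉ W`, multiplication by `x` does not
affect the bound on `W`, and that bound for `c` implies the one for `c'` on `insert x W`. -/
theorem monomialSub_inf_ker_stepSum (hx : x ∉ W) (hc : c = c' + Pi.single x.1 1) :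
    monomialSub k (Sum.elim (fun _ : PUnit.{w + 1} => degreeUpperSet (insert x W) c')
      fun _ : PUnit.{w + 1} => degreeUpperSet W c) ⊓ LinearMap.ker (stepSum k x) =
      (monomialSub k fun _ => degreeUpperSet W c).map (stepKer k x) := by
  ext z
  constructor
  · rintro ⟨hz, hk⟩
    have hk' : ∀ t, z (Sum.inr t) = -(MvPolynomial.X x * z (Sum.inl t)) := fun t => by
      rw [eq_neg_iff_add_eq_zero, add_comm, ← stepSum_apply, show stepSum k x z = 0 from hk]
      rfl
    refine ⟨freeFst z, fun t => ?_, ?_⟩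
    · refine mem_monomialIdeal_of_X_mul (U := degreeUpperSet W c) (V := degreeUpperSet W c) x
        (fun u hu i => ?_) ?_
      · have := hu i
        rwa [sum_single_add_degree hx] at this
      · have := Ideal.neg_mem_iff _ |>.2 (hz (Sum.inr t))
        rwa [hk', neg_neg] at this
    · refine Finsupp.ext ?_
      rintro (t | t)
      · rw [stepKer_inl]; rfl
      · rw [stepKer_inr, hk']; rfl
  · rintro ⟨p, hp, rfl⟩
    refine ⟨?_, ?_⟩
    · rintro (t | t)
      · rw [stepKer_inl]
        refine monomialIdeal_mono (fun u hu i => ?_) (hp t)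
        rw [sum_insert_degree hx]
        refine le_trans ?_ ((hu i).trans le_add_self)
        rw [hc]
        exact Nat.le_add_right _ _
      · rw [stepKer_inr]
        exact Submodule.neg_mem _ (Ideal.mul_mem_left _ _ (hp t))
    · refine LinearMap.mem_ker.2 (Finsupp.ext fun t => ?_)
      rw [stepSum_apply, stepKer_inl, stepKer_inr, add_neg_cancel]
      rfl

theorem stepKer_injective : Function.Injective (stepKer.{v, w} k x) :=
  Function.LeftInverse.injective (g := freeFst) fun p => Finsupp.ext fun t => stepKer_inl x p t

end Step

/-- The ideal of polynomials whose multidegree in the variables of `W` is at least `c` has a linear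
resolution. -/
theorem hasAvoidingRes_degreeUpperSet (W : Finset (Σ i : Fin r, Fin (n i + 1))) (c : Fin r → ℕ)
    (e : Fin r → ℤ) (j : ℕ)
    (h : ∀ l : Fin r → ℕ, ∑ i, l i = j → b ≠ e + (fun i => (c i : ℤ)) + fun i => (l i : ℤ)) :
    HasAvoidingRes.{v, w} b j (freeGrading fun _ : PUnit.{w + 1} => e)
      (monomialSub k fun _ => degreeUpperSet W c) := by
  induction W using Finset.induction_on generalizing c e j with
  | empty =>
    -- Without variables the ideal is the unit ideal for `c = 0` and zero otherwise.
    by_cases hc : c = 0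
    · subst hc
      have : monomialSub k (fun _ : PUnit.{w + 1} => degreeUpperSet (n := n) ∅ 0) = ⊤ :=
        eq_top_iff.2 fun f _ t u _ i => Nat.zero_le _
      rw [this]
      refine hasAvoidingRes_top ?_
      rintro rfl - rfl
      exact h 0 (by simp) (by ext; simp)
    · have : monomialSub k (fun _ : PUnit.{w + 1} => degreeUpperSet (n := n) ∅ c) = ⊥ := by
        refine (Submodule.eq_bot_iff _).2 fun f hf => Finsupp.ext fun t => ?_
        refine MvPolynomial.support_eq_empty.1 (Finset.eq_empty_of_forall_notMem fun u hu => ?_)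
        refine hc (funext fun i => ?_)
        simpa using hf t u hu i
      rw [this]
      exact hasAvoidingRes_bot j
  | insert x W hx ih =>
    obtain ⟨m, hm⟩ : ∃ m, c x.1 = m := ⟨_, rfl⟩
    -- Inner induction on the bound in the direction of `x`. When it is zero, `x` imposes nothing
    -- and can be dropped.
    induction m generalizing c e j with
    | zero =>
      convert ih c e j h using 3
      ext u
      refine forall_congr' fun i => ?_
      rw [sum_insert_degree hx]
      by_cases hi : x.1 = i
      · subst hi
        simp [hm]
      · simp [hi]
    | succ m ihm =>
      obtain ⟨c', hc⟩ : ∃ c' : Fin r → ℕ, c = c' + Pi.single x.1 1 := by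
        refine ⟨Function.update c x.1 m, funext fun i => ?_⟩
        by_cases hi : i = x.1
        · subst hi
          rw [Pi.add_apply, Function.update_self, Pi.single_eq_same, hm]
        · rw [Pi.add_apply, Function.update_of_ne hi, Pi.single_eq_of_ne hi, add_zero]
      have hB : HasAvoidingRes.{v, w} b j (freeGrading (Sum.elim (fun _ : PUnit.{w + 1} =>
          varDegree n x + e) fun _ : PUnit.{w + 1} => e))
          (monomialSub k (Sum.elim (fun _ : PUnit.{w + 1} => degreeUpperSet (insert x W) c')
            fun _ : PUnit.{w + 1} => degreeUpperSet W c)) := by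
        refine hasAvoidingRes_monomialSub _ _ ?_
        rintro (t | t)
        -- The twist by `x` compensates for lowering `c` to `c'`, so the generating degree `e + c`
        -- is unchanged.
        · refine ihm c' (varDegree n x + e) j (fun l hl hb => h l hl ?_) ?_
          · rw [hb, hc]
            ext i
            by_cases hi : i = x.1
            · subst hi
              simp [varDegree]
              ring
            · simp [varDegree, hi]
          · rw [hc] at hm
            simpa using hm
        · exact ih c e j h
      rw [← map_stepSum hx hc]
      cases j with
      | zero => exact hB.map_zero (isGradedMap_stepSum x e)
      | succ j =>
        refine .quotient (isGradedMap_stepSum x e) hB ?_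
        rw [monomialSub_inf_ker_stepSum hx hc]
        refine .map_injOn (ih c (varDegree n x + e) j ?_) (isGradedMap_stepKer x e) ?_
        · intro l hl hb
          -- The kernel is generated one step higher in the direction of `x` and enters the cone one
          -- homological step later, so linearity is preserved.
          refine h (l + Pi.single x.1 1) ?_ ?_
          · simp [Finset.sum_add_distrib, hl]
          · rw [hb]
            ext i
            by_cases hi : i = x.1
            · subst hi
              simp [varDegree]
              ring
            · simp [varDegree, hi]
        · rw [LinearMap.ker_eq_bot.2 stepKer_injective, inf_bot_eq]

end Monomial

/-! ### Truncations of graded modules -/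

section TruncationLemmas

variable {k : Type v} [Field k] {r : ℕ} {n : Fin r → ℕ}
  {N : Type*} [AddCommGroup N] [Module (CoxRing k n) N]
  {P : Type*} [AddCommGroup P] [Module (CoxRing k n) P]
  {𝒩 : (Fin r → ℤ) → AddSubgroup N} {d : Fin r → ℤ}

theorem mem_truncation_of_mem
    [SetLike.GradedSMul (coxGrading k n) 𝒩] {b : Fin r → ℤ} (hb : d ≤ b) {x : N} (hx : x ∈ 𝒩 b) :
    x ∈ truncation (k := k) (n := n) 𝒩 d :=
  AddSubgroup.mem_iSup_of_mem (S := fun b : Set.Ici d => 𝒩 b) ⟨b, hb⟩ hx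

variable [DirectSum.Decomposition 𝒩]

theorem mem_of_decompose_mem {K : Submodule (CoxRing k n) N} {x : N}
    (h : ∀ b, (DirectSum.decompose 𝒩 x b : N) ∈ K) : x ∈ K := by
  classical
  rw [← DirectSum.sum_support_decompose 𝒩 x]
  exact sum_mem fun b _ => h b

variable [SetLike.GradedSMul (coxGrading k n) 𝒩]
  {𝒬 : (Fin r → ℤ) → AddSubgroup P} [DirectSum.Decomposition 𝒬]
  [SetLike.GradedSMul (coxGrading k n) 𝒬]

theorem decompose_eq_zero_of_mem_truncation {x : N}
    (hx : x ∈ truncation (k := k) (n := n) 𝒩 d) {b : Fin r → ℤ} (hb : ¬ d ≤ b) :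
    (DirectSum.decompose 𝒩 x b : N) = 0 := by
  replace hx : x ∈ (⨆ b : Set.Ici d, 𝒩 b : AddSubgroup N) := hx
  induction hx using AddSubgroup.iSup_induction' with
  | hp c x hx => exact DirectSum.decompose_of_mem_ne _ hx fun h => hb (h ▸ c.2)
  | h1 => simp
  | hadd x y _ _ hx hy =>
    rw [DirectSum.decompose_add, DirectSum.add_apply, AddSubgroup.coe_add, hx, hy, add_zero]

theorem isHomogeneousSub_truncation :
    IsHomogeneousSub 𝒩 (truncation (k := k) (n := n) 𝒩 d) := by
  intro b x hx
  by_cases hb : d ≤ b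
  · exact mem_truncation_of_mem hb (SetLike.coe_mem _)
  · rw [decompose_eq_zero_of_mem_truncation hx hb]
    exact Submodule.zero_mem _

/-- Truncation selects graded parts and graded maps respect them; this is the exactness of
truncation. -/
theorem map_truncation {f : N →ₗ[CoxRing k n] P} (hf : IsGradedMap 𝒩 𝒬 f) :
    (truncation (k := k) (n := n) 𝒩 d).map f =
      LinearMap.range f ⊓ truncation (k := k) (n := n) 𝒬 d := by
  refine le_antisymm ?_ ?_
  · rintro _ ⟨x, hx, rfl⟩
    refine ⟨⟨x, rfl⟩, mem_of_decompose_mem (𝒩 := 𝒬) fun b => ?_⟩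
    rw [hf.decompose]
    by_cases hb : d ≤ b
    · exact mem_truncation_of_mem hb (hf _ _ (SetLike.coe_mem _))
    · rw [decompose_eq_zero_of_mem_truncation hx hb, map_zero]
      exact Submodule.zero_mem _
  · rintro _ ⟨⟨x, rfl⟩, hx⟩
    refine mem_of_decompose_mem (𝒩 := 𝒬) fun b => ?_
    by_cases hb : d ≤ b
    · rw [hf.decompose]
      exact ⟨_, mem_truncation_of_mem hb (SetLike.coe_mem _), rfl⟩
    · rw [decompose_eq_zero_of_mem_truncation hx hb]
      exact Submodule.zero_mem _

/-- Weights are nonnegative, so replacing negative entries of `c` by zero loses nothing. -/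
theorem mem_degreeUpperSet_univ {c : Fin r → ℤ} {u : (Σ i : Fin r, Fin (n i + 1)) →₀ ℕ} :
    u ∈ degreeUpperSet Finset.univ (fun i => (c i).toNat) ↔
      c ≤ Finsupp.weight (varDegree n) u := by
  rw [mem_degreeUpperSet, Pi.le_def]
  refine forall_congr' fun i => ?_
  rw [weight_varDegree_apply, Int.toNat_le]
  push_cast
  rfl

theorem truncation_freeGrading {ι : Type*} (deg : ι → Fin r → ℤ) :
    truncation (k := k) (n := n) (freeGrading deg) d =
      monomialSub k fun a => degreeUpperSet Finset.univ fun i => (d i - deg a i).toNat := by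
  have key : ∀ a u, u ∈ degreeUpperSet (n := n) Finset.univ (fun i => (d i - deg a i).toNat) ↔
      d ≤ Finsupp.weight (varDegree n) u + deg a := fun a u =>
    (mem_degreeUpperSet_univ (c := d - deg a)).trans sub_le_iff_le_add
  refine le_antisymm (fun x hx => ?_) (fun x hx => ?_)
  · refine mem_of_decompose_mem (𝒩 := freeGrading deg) fun b a u hu => ?_
    by_cases hb : d ≤ b
    · rw [key, (DirectSum.decompose (freeGrading (k := k) (n := n) deg) x b).2 a
        (MvPolynomial.mem_support_iff.1 hu), sub_add_cancel]
      exact hb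
    · rw [decompose_eq_zero_of_mem_truncation hx hb] at hu
      simp at hu
  · refine mem_of_decompose_mem (𝒩 := freeGrading deg) fun b => ?_
    by_cases hb : d ≤ b
    · exact mem_truncation_of_mem hb (SetLike.coe_mem _)
    · have : (DirectSum.decompose (freeGrading (k := k) (n := n) deg) x b :
          ι →₀ CoxRing k n) = 0 := by
        refine Finsupp.ext fun a => MvPolynomial.support_eq_empty.1
          (Finset.eq_empty_of_forall_notMem fun u hu => hb ?_)
        have h1 := (key a u).1 (isHomogeneousSub_monomialSub deg _ b x hx a u hu)
        rwa [(DirectSum.decompose (freeGrading (k := k) (n := n) deg) x b).2 a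
          (MvPolynomial.mem_support_iff.1 hu), sub_add_cancel] at h1
      rw [this]
      exact Submodule.zero_mem _

/-- The resolution of the truncation of a graded free module. -/
theorem hasAvoidingRes_truncation_freeGrading {b : Fin r → ℤ} {ι : Type*} [Finite ι]
    (deg : ι → Fin r → ℤ) (j : ℕ)
    (h : ∀ a, ∀ l : Fin r → ℕ, ∑ i, l i = j → b ≠ fun i => max (d i) (deg a i) + l i) :
    HasAvoidingRes.{v, w} b j (freeGrading (k := k) (n := n) deg)
      (truncation (k := k) (n := n) (freeGrading deg) d) := by
  rw [truncation_freeGrading]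
  refine hasAvoidingRes_monomialSub _ _ fun a => hasAvoidingRes_degreeUpperSet _ _ _ _ ?_
  intro l hl hb
  -- In each coordinate, `deg a` plus the positive part of `d - deg a` is `max(d, deg a)`.
  refine h a l hl (hb.trans (funext fun i => ?_))
  simp only [Pi.add_apply]
  omega

end TruncationLemmas

/-! ### Resolutions of truncations -/

section Main

variable {k : Type v} [Field k] {r : ℕ} {n : Fin r → ℕ}

/-- The truncated syzygies of a minimal resolution. -/
theorem hasAvoidingRes_truncated_syzygy {b d : Fin r → ℤ} {s : ℕ → MinimalStage.{v, w} k n}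
    {δ : ∀ i, ((s (i + 1)).ι →₀ CoxRing k n) →ₗ[CoxRing k n] ((s i).ι →₀ CoxRing k n)}
    (hδ : ∀ i, MinimalStage.Covers (s (i + 1)) (s i) (δ i)) {D : ℕ → Set (Fin r → ℤ)}
    (hD : ∀ i j a, ∀ l : Fin r → ℕ, ∑ t, l t = j →
      (fun t => max (d t) ((s i).deg a t) + l t) ∈ D (i + j)) (j i : ℕ) (hb : b ∉ D (i + 1 + j)) :
    HasAvoidingRes.{v, w} b j (freeGrading (s i).deg)
      ((s i).K ⊓ truncation (k := k) (n := n) (freeGrading (s i).deg) d) := by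
  have hfree : ∀ i j, b ∉ D (i + j) →
      HasAvoidingRes.{v, w} b j (freeGrading (k := k) (n := n) (s i).deg)
      (truncation (k := k) (n := n) (freeGrading (s i).deg) d) := by
    intro i j hb
    have := (s i).finite
    refine hasAvoidingRes_truncation_freeGrading _ _ ?_
    rintro a l hl rfl
    exact hb (hD i j a l hl)
  induction j generalizing i with
  | zero =>
    rw [← (hδ i).2.1, ← map_truncation (hδ i).1]
    exact (hfree (i + 1) 0 hb).map_zero (hδ i).1
  | succ j ih =>
    rw [← (hδ i).2.1, ← map_truncation (hδ i).1]
    -- The truncated syzygy is the quotient of the truncated `F_{i+1}` by the next truncated syzygy.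
    -- The latter is needed only up to step `j`, so `i + 1 + j` keeps its value along the induction.
    refine .quotient (hδ i).1 (hfree (i + 1) (j + 1) hb) ?_
    rw [(hδ i).2.2, inf_comm]
    exact ih (i + 1) (by rwa [show i + 1 + 1 + j = i + 1 + (j + 1) by ring])

variable {M : Type u} [AddCommGroup M] [Module (CoxRing k n) M] [Module.Finite (CoxRing k n) M]
  (ℳ : (Fin r → ℤ) → AddSubgroup M) [DirectSum.Decomposition ℳ]
  [SetLike.GradedSMul (coxGrading k n) ℳ]

/-- The last mapping cone, at the augmentation of the truncated minimal resolution. `D` stands for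
any family of degree sets containing all degrees that the cones can produce. -/
theorem hasAvoidingRes_truncation {b d : Fin r → ℤ} {D : ℕ → Set (Fin r → ℤ)}
    (hD : ∀ i j, ∀ c ∈ bettiDegrees (k := k) (n := n) ℳ i, ∀ l : Fin r → ℕ, ∑ t, l t = j →
      (fun t => max (d t) (c t) + l t) ∈ D (i + j)) {j : ℕ} (hb : b ∉ D j) :
    HasAvoidingRes.{v, max u v} b j ℳ (truncation (k := k) (n := n) ℳ d) := by
  obtain ⟨s, δ, f, hδ, hf, hr, hk⟩ := exists_minimal_resolution.{v, max u v} (𝒩 := ℳ)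
    (K := (⊤ : Submodule (CoxRing k n) M)) .top Module.Finite.fg_top
  have hDs : ∀ i j a, ∀ l : Fin r → ℕ, ∑ t, l t = j →
      (fun t => max (d t) ((s i).deg a t) + l t) ∈ D (i + j) := fun i j a =>
    hD i j _ (deg_mem_bettiDegrees hδ hf hk hr i a)
  have hfree : HasAvoidingRes.{v, max u v} b j (freeGrading (k := k) (n := n) (s 0).deg)
      (truncation (k := k) (n := n) (freeGrading (s 0).deg) d) := by
    have := (s 0).finite
    refine hasAvoidingRes_truncation_freeGrading _ _ ?_
    rintro a l hl rfl
    exact hb (by simpa using hDs 0 j a l hl)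
  have hmap := map_truncation (d := d) hf
  rw [hr, top_inf_eq] at hmap
  rw [← hmap]
  cases j with
  | zero => exact hfree.map_zero hf
  | succ j =>
    refine .quotient hf hfree ?_
    rw [hk, inf_comm]
    exact hasAvoidingRes_truncated_syzygy hδ hDs j 0 (by rwa [zero_add, add_comm])

/-- The truncation of `M` has a resolution with degrees bounded in terms of the Betti degrees
of `M`. -/
theorem exists_truncation_resolution {d : Fin r → ℤ} {D : ℕ → Set (Fin r → ℤ)}
    (hD : ∀ i j, ∀ c ∈ bettiDegrees (k := k) (n := n) ℳ i, ∀ l : Fin r → ℕ, ∑ t, l t = j →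
      (fun t => max (d t) (c t) + l t) ∈ D (i + j)) :
    ∃ F : GradedFreeResolution (k := k) (n := n) (truncationGrading (k := k) (n := n) ℳ d),
      (∀ j a, F.deg j a ∈ D j) ∧ ∀ a, d ≤ F.deg 0 a := by
  have hfg : (truncation (k := k) (n := n) ℳ d).FG := by
    have : IsNoetherian (CoxRing k n) M := inferInstance
    exact IsNoetherian.noetherian _
  obtain ⟨s, δ, f, hδ, hf, hr, hk⟩ := exists_minimal_resolution.{v, max u v} (𝒩 := ℳ)
    isHomogeneousSub_truncation hfg
  have hmem : ∀ x, f x ∈ truncation (k := k) (n := n) ℳ d := fun x => hr ▸ ⟨x, rfl⟩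
  refine ⟨{
    ι := fun i => (s i).ι
    deg := fun i => (s i).deg
    d := δ
    aug := f.codRestrict _ hmem
    d_mem := fun i => (hδ i).1
    aug_mem := fun b x hx => hf b x hx
    exact := fun i => LinearMap.exact_iff.2 ((hδ i).2.2.trans (hδ (i + 1)).2.1.symm)
    exact_aug := LinearMap.exact_iff.2 ?_
    aug_surjective := ?_ }, ?_, ?_⟩
  · rw [LinearMap.ker_codRestrict, hk, (hδ 0).2.1]
  · rintro ⟨y, hy⟩
    obtain ⟨x, hx⟩ : y ∈ LinearMap.range f := hr ▸ hy
    exact ⟨x, Subtype.ext hx⟩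
  · intro j a
    by_contra hb
    -- An avoiding resolution made for this `j` and this degree alone suffices to contradict the
    -- existence of the generator `a`.
    obtain ⟨κ, deg, g, hg, hrg, h⟩ := hasAvoidingRes_truncation ℳ hD hb
    cases j with
    | zero =>
      refine deg_ne_of_minimal_cover hf (hk.trans_le (s 0).le) (fun x hx hxb => ?_) a rfl
      rw [hr, ← hrg] at hx ⊢
      exact mem_smul_range_of_avoiding hg h hxb hx
    | succ j =>
      exact deg_succ_ne_of_syzygyTorVanishes hδ hf hk hg (hr.trans hrg.symm)
        h.syzygyTorVanishes a rfl
  · intro a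
    by_contra hda
    -- A generator in a degree not at least `d` would map to zero, so its basis element would lie in
    -- the kernel, inside `𝔪F`.
    have h1 := decompose_eq_zero_of_mem_truncation (hmem (Finsupp.single a 1)) hda
    rw [DirectSum.decompose_of_mem_same _ (hf _ _ (single_one_mem_freeGrading _ a))] at h1
    exact single_one_notMem_varIdeal_smul_top (k := k) (n := n) a
      ((s 0).le (hk.le (LinearMap.mem_ker.2 h1)))

end Main

/-! ### The regions -/

section Regions

variable {r : ℕ}

theorem mem_regionL_iff {i : ℕ} {d e : Fin r → ℤ} :
    e ∈ regionL i d ↔ ∃ l : Fin r → ℕ, ∑ j, l j = i ∧ ∀ j, d j ≤ e j + l j := by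
  simp [regionL, Pi.le_def]

/-- If `c ≤ d + m` with `|m| = i`, then `max(d, c) + l ≤ d + (m + l)` and `|m + l| = i + j`. -/
theorem neg_max_add_mem_regionL {i j : ℕ} {d c : Fin r → ℤ} (hd : d ∈ regionL i c)
    {l : Fin r → ℕ} (hl : ∑ t, l t = j) :
    (-fun t => max (d t) (c t) + (l t : ℤ)) ∈ regionL (i + j) (-d) := by
  obtain ⟨m, hm, h⟩ := mem_regionL_iff.1 hd
  refine mem_regionL_iff.2 ⟨m + l, by simp [Finset.sum_add_distrib, hm, hl], fun t => ?_⟩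
  have := h t
  simp only [Pi.neg_apply, Pi.add_apply]
  push_cast
  omega

/-- For `i > 0`, `c ≤ d + m + 1` with `|m| = i - 1` gives `max(d, c) + l ≤ d + 1 + (m + l)`. For `i
= 0` the maximum is `d`, and the extra `1` in `Q_j` pays for one unit of `l`. -/
theorem neg_max_add_mem_regionQ {i j : ℕ} {d c : Fin r → ℤ} (hd : d ∈ regionQ i c)
    {l : Fin r → ℕ} (hl : ∑ t, l t = j) :
    (-fun t => max (d t) (c t) + (l t : ℤ)) ∈ regionQ (i + j) (-d) := by
  cases i with
  | zero =>
    have hcd : c ≤ d := hd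
    cases j with
    | zero =>
      intro t
      have h0 : l t = 0 := Finset.sum_eq_zero_iff.1 hl t (Finset.mem_univ t)
      have : c t ≤ d t := hcd t
      simp only [Pi.neg_apply]
      omega
    | succ j =>
      obtain ⟨t₀, -, ht₀⟩ := Finset.exists_ne_zero_of_sum_ne_zero (hl.trans_ne j.succ_ne_zero)
      -- `Q_{j+1}` allows a vector of sum only `j`, so a nonzero entry of `l` is lowered by one.
      have e : l = Function.update l t₀ (l t₀ - 1) + Pi.single t₀ 1 := by
        ext t
        by_cases h : t = t₀
        · subst h
          simp
          omega
        · simp [h]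
      rw [zero_add]
      refine mem_regionL_iff.2 ⟨Function.update l t₀ (l t₀ - 1), ?_, fun t => ?_⟩
      · rw [e] at hl
        simpa [Finset.sum_add_distrib] using hl
      · have : c t ≤ d t := hcd t
        simp only [Pi.neg_apply, Pi.sub_apply, Pi.one_apply]
        by_cases h : t = t₀
        · subst h
          rw [Function.update_self]
          omega
        · rw [Function.update_of_ne h]
          omega
  | succ i =>
    obtain ⟨m, hm, h⟩ := mem_regionL_iff.1 hd
    rw [add_right_comm]
    refine mem_regionL_iff.2 ⟨m + l, by simp [Finset.sum_add_distrib, hm, hl], fun t => ?_⟩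
    have := h t
    simp only [Pi.neg_apply, Pi.add_apply, Pi.sub_apply, Pi.one_apply] at this ⊢
    push_cast
    omega

end Regions

end Multigraded

theorem theoremB {k : Type v} [Field k] {r : ℕ} (n : Fin r → ℕ)
    {M : Type u} [AddCommGroup M] [Module (Multigraded.CoxRing k n) M]
    [Module.Finite (Multigraded.CoxRing k n) M]
    (ℳ : (Fin r → ℤ) → AddSubgroup M) [DirectSum.Decomposition ℳ]
    [SetLike.GradedSMul (Multigraded.coxGrading k n) ℳ] :
    (∀ d ∈ ⋂ i : ℕ, ⋂ b ∈ Multigraded.bettiDegrees (k := k) (n := n) ℳ i, Multigraded.regionQ i b,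
      ∃ F : Multigraded.GradedFreeResolution (k := k) (n := n)
          (Multigraded.truncationGrading (k := k) (n := n) ℳ d), F.IsQuasilinear d) ∧
    (∀ d ∈ ⋂ i : ℕ, ⋂ b ∈ Multigraded.bettiDegrees (k := k) (n := n) ℳ i, Multigraded.regionL i b,
      ∃ F : Multigraded.GradedFreeResolution (k := k) (n := n)
          (Multigraded.truncationGrading (k := k) (n := n) ℳ d), F.IsLinear d) := by
  refine ⟨fun d hd => ?_, fun d hd => ?_⟩
  · simp only [Set.mem_iInter] at hd
    obtain ⟨F, hF, h0⟩ := Multigraded.exists_truncation_resolution ℳ (d := d)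
      (D := fun j => {c | -c ∈ Multigraded.regionQ j (-d)})
      fun i j c hc l hl => Multigraded.neg_max_add_mem_regionQ (hd i c hc) hl
    -- The region for `j = 0` bounds the generator degrees above by `d`, and the truncation bounds
    -- them below by `d`.
    exact ⟨F, fun a => le_antisymm (neg_le_neg_iff.1 (hF 0 a)) (h0 a), hF⟩
  · simp only [Set.mem_iInter] at hd
    obtain ⟨F, hF, h0⟩ := Multigraded.exists_truncation_resolution ℳ (d := d)
      (D := fun j => {c | -c ∈ Multigraded.regionL j (-d)})
      fun i j c hc l hl => Multigraded.neg_max_add_mem_regionL (hd i c hc) hl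
    refine ⟨F, fun a => le_antisymm (fun t => ?_) (h0 a), hF⟩
    obtain ⟨l, hl, h⟩ := Multigraded.mem_regionL_iff.1 (hF 0 a)
    have hlt : l t = 0 := Finset.sum_eq_zero_iff.1 hl t (Finset.mem_univ t)
    have ht := h t
    simp only [Pi.neg_apply, hlt] at ht
    show F.deg 0 a t ≤ d t
    omega
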